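/- **Setting.** Let $(Z,\mathfrak Z,\nu)$ be a $\sigma$-finite measure space and let $\eta$ be a Poisson point process on $Z$ with intensity $\nu$, defined on a probability space $(\Omega,\mathfrak O,\mathbb P)$; let $\mathfrak W=\sigma(\eta)$. For a real $\mathfrak W$-measurable random variable $F=f(\eta)$ put $D_zF=D_z^+F=f(\eta+\delta_z)-f(\eta)$. Write $F\in\operatorname{dom}D$ if $F\in L^2(\mathbb P)$ and $DF\in L^2(\mathbb P\otimes\nu)$. Let $\delta$ be the adjoint of $D$: a square-integrable $\mathfrak W\otimes\mathfrak Z$-measurable $u$ is in $\operatorname{dom}\delta$ if $|\mathbb E\,\nu(u\,DG)|\le c\,(\mathbb E G^2)^{1/2}$ for some $c>0$ and all $G\in\operatorname{dom}D$, and then $\delta u\in L^2(\Omega,\mathfrak W,\mathbb P)$ is determined by $\mathbb E[G\,\delta u]=\mathbb E\,\nu(u\,DG)$ for all $G\in\operatorname{dom}D$. A sequence of $\mathfrak W$-measurable variables $X_n$ converges stably to $X$ if $(X_n,V)\to(X,V)$ in law for every bounded $\mathfrak W$-measurable $V$. The Monge–Kantorovich distance $d_1(X,Y)$ between (the laws of)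 $X$ and $Y$ is the infimum of $\mathbb E|\tilde X-\tilde Y|$ over all couplings $\tilde X\sim X$, $\tilde Y\sim Y$. For a real random variable $T$, $\mathbf N(0,T^2)$ denotes the law of $TN$, where $N$ is a standard Gaussian variable independent of $T$. **Assumptions.** Let $F_n\in\operatorname{dom}D$ and $u_n\in\operatorname{dom}\delta$ be real-valued with $F_n=\delta u_n$ for all $n\in\mathbb N$, and let $S\in L^2(\Omega,\mathfrak O,\mathbb P)$ be real-valued (not necessarily $\mathfrak W$-measurable). Assume that, for all $n\ge n_0$, $\nu(u_nDF_n)=S_n^2+\epsilon_n$ almost surely, where $S_n\in\operatorname{dom}D$ and $\epsilon_n$ is a real $\mathfrak W$-measurable random variable, and that, as $n\to\infty$, $S_n^2\to S^2$ stably and - $\mathbb E|\nu(u_nh)|\to0$, $\ \mathbb E\,\nu(|h|\,|DF_n|^2)\to0$ and $\mathbb E\,\nu(|h|\,|DS_n|^2)\to0$ for every $h\in L^2(\nu)$; - $\mathbb E\,\nu(|u_n|\,|DF_n|^2)\to0$ and $\mathbb E\,\nu(|u_n|\,|DS_n|^2)\to0$; - $\mathbb E|\epsilon_n|\to0$ and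 $\mathbb E|S_n\,\nu(u_nDS_n)|\to0$. **Theorem.** Let $$\Delta_{1,n}=\Big(\frac2\pi\Big)^{1/2}\big(2+\mathbb E|S_n|\big)+\mathbb E|F_n|,$$ $$\Delta_{2,n}=\frac14\Big(\frac2\pi\Big)^{1/2}\mathbb E|\epsilon_n|+2^{1/2}\Big(\frac13\,\mathbb E|S_n\,\nu(u_nDS_n)|+\frac16\,\mathbb E\,\nu\big(|u_n|(|DF_n|^2+|DS_n|^2)\big)\Big).$$ Then, for all $n\ge n_0$, $$d_1\big(F_n,\mathbf N(0,S^2)\big)\le\max\Big(\big(2^{1/3}+2^{-2/3}\big)\Delta_{1,n}^{2/3}\Delta_{2,n}^{1/3},\ \Delta_{1,n}\Delta_{2,n}\Big)+\Big(\frac2\pi\Big)^{1/2}d_1(S_n,S),$$ and moreover $d_1\big(\mathbf N(0,S_n^2),\mathbf N(0,S^2)\big)\le\big(\frac2\pi\big)^{1/2}d_1(S_n,S)$. (The quantities $\mathbb E|\epsilon_n|$, $\mathbb E|S_n\nu(u_nDS_n)|$, etc. take values in $[0,\infty]$.) -/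

import Mathlib

open MeasureTheory ProbabilityTheory Filter Topology
open scoped ENNReal NNReal

namespace PoissonSpace

/-- `μ` is a countable sum of `ℕ`-valued measures. -/
def IsPointMeasure {Z : Type*} [MeasurableSpace Z] (μ : Measure Z) : Prop :=
  ∃ m : ℕ → Measure Z,
    (∀ i, ∀ B, MeasurableSet B → ∃ k : ℕ, m i B = (k : ℝ≥0∞)) ∧ μ = Measure.sum m

/-- The space of all countable sums of `ℕ`-valued measures on `Z`. Its σ-algebra, inherited from
`Measure Z`, is generated by the evaluations `ξ ↦ ξ B`, with `B` measurable. -/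
abbrev PointMeasure (Z : Type*) [MeasurableSpace Z] : Type _ :=
  {μ : Measure Z // IsPointMeasure μ}

theorem IsPointMeasure.add_dirac {Z : Type*} [MeasurableSpace Z] {μ : Measure Z}
    (h : IsPointMeasure μ) (z : Z) : IsPointMeasure (μ + Measure.dirac z) := by
  classical
  obtain ⟨m, hm, rfl⟩ := h
  refine ⟨fun i => Nat.casesOn i (Measure.dirac z) m, ?_, ?_⟩
  · rintro (_ | i) B hB
    · by_cases hz : z ∈ B
      · exact ⟨1, by simp [Measure.dirac_apply' z hB, hz]⟩
      · exact ⟨0, by simp [Measure.dirac_apply' z hB, hz]⟩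
    · exact hm i B hB
  · ext B hB
    rw [Measure.add_apply, Measure.sum_apply _ hB, Measure.sum_apply _ hB, add_comm]
    exact (tsum_eq_zero_add' (f := fun i : ℕ =>
      (Nat.casesOn i (Measure.dirac z) m : Measure Z) B) ENNReal.summable).symm

/-- The configuration `ξ + δ_z`. -/
noncomputable def addPoint {Z : Type*} [MeasurableSpace Z] (ξ : PointMeasure Z) (z : Z) :
    PointMeasure Z :=
  ⟨ξ.1 + Measure.dirac z, ξ.2.add_dirac z⟩

/-- `η` is a Poisson point process with intensity measure `ν`. -/
structure IsPoissonProcess {Ω Z : Type*} [MeasurableSpace Ω] [MeasurableSpace Z]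
    (η : Ω → PointMeasure Z) (P : Measure Ω) (ν : Measure Z) : Prop where
  measurable : Measurable η
  indep : ∀ (k : ℕ) (B : Fin k → Set Z), (∀ i, MeasurableSet (B i)) →
    Pairwise (fun i j => Disjoint (B i) (B j)) →
    iIndepFun (fun (i : Fin k) (ω : Ω) => (η ω).1 (B i)) P
  law : ∀ B : Set Z, MeasurableSet B → ν B < ∞ →
    P.map (fun ω => (η ω).1 B) =
      (poissonMeasure (ν B).toNNReal).map (fun k : ℕ => (k : ℝ≥0∞))

/-- The add operator `D⁺_z F = F(η + δ_z) - F(η)`. A random variable measurable with respect to `η`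
is given by a representative, a measurable function `F` of the configuration. -/
noncomputable def addOp {Z : Type*} [MeasurableSpace Z] (F : PointMeasure Z → ℝ)
    (ξ : PointMeasure Z) (z : Z) : ℝ :=
  F (addPoint ξ z) - F ξ

/-- `F(η)` belongs to the domain of the Malliavin derivative. -/
structure MemDomD {Ω Z : Type*} [MeasurableSpace Ω] [MeasurableSpace Z]
    (η : Ω → PointMeasure Z) (P : Measure Ω) (ν : Measure Z) (F : PointMeasure Z → ℝ) : Prop where
  measurable : Measurable F
  memLp : MemLp (fun ω => F (η ω)) 2 P
  memLp_addOp : MemLp (fun p : Ω × Z => addOp F (η p.1) p.2) 2 (P.prod ν)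

/-- The pairing `𝔼 ∫ u(z) D⁺_z G ν(dz)`. -/
noncomputable def pairing {Ω Z : Type*} [MeasurableSpace Ω] [MeasurableSpace Z]
    (η : Ω → PointMeasure Z) (P : Measure Ω) (ν : Measure Z)
    (u : PointMeasure Z → Z → ℝ) (G : PointMeasure Z → ℝ) : ℝ :=
  ∫ ω, ∫ z, u (η ω) z * addOp G (η ω) z ∂ν ∂P

/-- `u` belongs to the domain of the divergence operator `δ`, the adjoint of `D`. -/
structure MemDomDelta {Ω Z : Type*} [MeasurableSpace Ω] [MeasurableSpace Z]
    (η : Ω → PointMeasure Z) (P : Measure Ω) (ν : Measure Z)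
    (u : PointMeasure Z → Z → ℝ) : Prop where
  measurable : Measurable (Function.uncurry u)
  memLp : MemLp (fun p : Ω × Z => u (η p.1) p.2) 2 (P.prod ν)
  bound : ∃ c : ℝ, 0 < c ∧ ∀ G : PointMeasure Z → ℝ, MemDomD η P ν G →
    |pairing η P ν u G| ≤ c * Real.sqrt (∫ ω, (G (η ω)) ^ 2 ∂P)

/-- `u` belongs to the domain of `δ` and `F = δ u`: `F` is the square integrable random variable such that
`𝔼[G F] = 𝔼 ∫ u(z) D⁺_z G ν(dz)` for all `G` in the domain of `D`. -/
structure IsDivergence {Ω Z : Type*} [MeasurableSpace Ω] [MeasurableSpace Z]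
    (η : Ω → PointMeasure Z) (P : Measure Ω) (ν : Measure Z)
    (u : PointMeasure Z → Z → ℝ) (F : PointMeasure Z → ℝ) : Prop where
  mem_dom : MemDomDelta η P ν u
  measurable : Measurable F
  memLp : MemLp (fun ω => F (η ω)) 2 P
  duality : ∀ G : PointMeasure Z → ℝ, MemDomD η P ν G →
    ∫ ω, G (η ω) * F (η ω) ∂P = pairing η P ν u G

/-- The bracket `[u, v]_ν = ∫ u(z) v(z) ν(dz)`. -/
noncomputable def bracket {Z : Type*} [MeasurableSpace Z] (ν : Measure Z) (u v : Z → ℝ) : ℝ :=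
  ∫ z, u z * v z ∂ν

/-- Stable convergence of `X n` to `Y` with respect to the σ-algebra generated by `η`: for every
bounded random variable `V` measurable with respect to `η`, `(X n, V)` converges in law to
`(Y, V)`. -/
def StableConvergence {Ω Z : Type*} [MeasurableSpace Ω] [MeasurableSpace Z]
    (η : Ω → PointMeasure Z) (P : Measure Ω) [IsProbabilityMeasure P]
    (X : ℕ → Ω → ℝ) (Y : Ω → ℝ) : Prop :=
  ∀ V : Ω → ℝ, Measurable[MeasurableSpace.comap η inferInstance] V → MemLp V ∞ P →
    TendstoInDistribution (fun n ω => (X n ω, V ω)) atTop (fun ω => (Y ω, V ω))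
      (fun _ => P) P

/-- The law `𝐍(0, S²)` of `S N`, where `S` has law `μ` and `N` is a standard Gaussian variable
independent of `S`. -/
noncomputable def gaussianMixture (μ : Measure ℝ) : Measure ℝ :=
  (μ.prod (gaussianReal 0 1)).map (fun p : ℝ × ℝ => p.1 * p.2)

/-- The Monge-Kantorovich distance `d₁` between two laws on `ℝ`: the infimum of `𝔼|X - Y|` over all
couplings `(X, Y)`. -/
noncomputable def d1 (μ₁ μ₂ : Measure ℝ) : ℝ≥0∞ :=
  ⨅ (π : Measure (ℝ × ℝ)) (_ : π.map Prod.fst = μ₁) (_ : π.map Prod.snd = μ₂),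
    ∫⁻ p, ‖p.1 - p.2‖ₑ ∂π

/-- `Δ₁ = (2/π)^{1/2} (2 + 𝔼|S|) + 𝔼|F|`. -/
noncomputable def Delta1 {Ω Z : Type*} [MeasurableSpace Ω] [MeasurableSpace Z]
    (η : Ω → PointMeasure Z) (P : Measure Ω) (F S : PointMeasure Z → ℝ) : ℝ≥0∞ :=
  ENNReal.ofReal (Real.sqrt (2 / Real.pi)) * (2 + ∫⁻ ω, ‖S (η ω)‖ₑ ∂P) + ∫⁻ ω, ‖F (η ω)‖ₑ ∂P

/-- `Δ₂ = (1/4) (2/π)^{1/2} 𝔼|ε|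
  + 2^{1/2} ((1/3) 𝔼|S ν(u DS)| + (1/6) 𝔼 ν(|u| (|DF|² + |DS|²)))`. -/
noncomputable def Delta2 {Ω Z : Type*} [MeasurableSpace Ω] [MeasurableSpace Z]
    (η : Ω → PointMeasure Z) (P : Measure Ω) (ν : Measure Z)
    (u : PointMeasure Z → Z → ℝ) (F S ε : PointMeasure Z → ℝ) : ℝ≥0∞ :=
  ENNReal.ofReal (1 / 4 * Real.sqrt (2 / Real.pi)) * ∫⁻ ω, ‖ε (η ω)‖ₑ ∂P
    + ENNReal.ofReal (Real.sqrt 2) *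
      (ENNReal.ofReal (1 / 3) *
          ∫⁻ ω, ‖S (η ω) * bracket ν (u (η ω)) (addOp S (η ω))‖ₑ ∂P
        + ENNReal.ofReal (1 / 6) *
          ∫⁻ ω, ∫⁻ z, ‖u (η ω) z‖ₑ *
            (‖addOp F (η ω) z‖ₑ ^ 2 + ‖addOp S (η ω) z‖ₑ ^ 2) ∂ν ∂P)

end PoissonSpace

open PoissonSpace

/-! The law of `F n` is compared with the mixture of law `S_n N` by a Gaussian interpolation, and
the triangle inequality then replaces `S_n` by `S`. The second comparison is a coupling argument:
multiplying both members of a coupling of `S_n` and `S` by the same independent `N` costs the factor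
E|N| = √(2/π).

For a test function `f`, set X_θ = sin θ · F + cos θ · S_n N, which runs from S_n N to F. The
derivative of E f(X_θ) is E f'(X_θ)(cos θ · F − sin θ · S_n N). Since F = δu, duality and a Taylor
expansion turn the first term into E f''(X_θ) ν(u DF), up to errors; Gaussian integration by parts
turns the second into E f''(X_θ) S_n². The weights are both sin θ cos θ, so the main parts cancel
and only ε_n is left. The errors are the Taylor remainder, quadratic in the add operators because D
is a difference and not a derivation, and the term with N ν(u DS_n), where averaging over N gains a
factor S_n. This is `abs_integral_deriv_interpolation_le`, integrated over [0, π/2] in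
`abs_integral_test_sub_le`. It needs only a bound on f'' and a Lipschitz constant of f''.

A 1-Lipschitz test function is smoothed by a triangular kernel of width σ, at the cost σ/3 on each
side. Optimising in σ, with the trivial bound by first moments for large errors, gives the power
2/3, 1/3 estimate (`le_of_smoothing_bounds`). The trivial bound makes the first entry of the maximum
sufficient in every regime.

Passing from Lipschitz functions to `d1` uses the one-dimensional formula `d1_eq_lintegral_cdf`,
from which both the triangle inequality and the needed half of Kantorovich duality follow. -/

/-! ### Optimal transport on the line: distribution functions, quantiles and duality. -/

namespace RealTransport

/-- The indicator of `x ≤ t`. -/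
noncomputable def step (x t : ℝ) : ℝ := if x ≤ t then 1 else 0

theorem measurable_step {α : Type*} [MeasurableSpace α] {f g : α → ℝ} (hf : Measurable f)
    (hg : Measurable g) : Measurable fun a => step (f a) (g a) :=
  Measurable.ite (measurableSet_le hf hg) measurable_const measurable_const

theorem norm_step_le (x t : ℝ) : ‖step x t‖ ≤ 1 := by
  unfold step; split_ifs <;> simp

theorem step_sub_step_of_le {x y : ℝ} (h : x ≤ y) :
    (fun t => step x t - step y t) = (Set.Ico x y).indicator fun _ => (1 : ℝ) := by
  ext t
  by_cases h1 : x ≤ t <;> by_cases h2 : y ≤ t <;>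
    simp [step, Set.indicator, h1, h2]
  · exact absurd (h.trans h2) h1

theorem step_sub_step_of_le' {x y : ℝ} (h : x ≤ y) :
    (fun u => step u y - step u x) = (Set.Ioc x y).indicator fun _ => (1 : ℝ) := by
  ext t
  by_cases h1 : t ≤ x <;> by_cases h2 : t ≤ y <;>
    simp [step, Set.indicator, h1, h2, not_lt.2, not_le.1]
  · exact h2 (h1.trans h)

theorem enorm_sub_comm (x y : ℝ) : ‖x - y‖ₑ = ‖y - x‖ₑ := by
  rw [← enorm_neg, neg_sub]

theorem lintegral_enorm_step_sub_step (x y : ℝ) :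
    ∫⁻ t, ‖step x t - step y t‖ₑ = ‖x - y‖ₑ := by
  wlog h : x ≤ y generalizing x y
  · simp_rw [enorm_sub_comm x y, ← this y x (le_of_not_ge h), enorm_sub_comm (step x _)]
  have := step_sub_step_of_le h
  simp_rw [fun t => congrFun this t, enorm_indicator_eq_indicator_enorm]
  rw [lintegral_indicator measurableSet_Ico]
  simp [enorm_sub_comm x y, Real.enorm_eq_ofReal (sub_nonneg.2 h)]

theorem lintegral_enorm_step_sub_step' (x y : ℝ) :
    ∫⁻ u, ‖step u x - step u y‖ₑ = ‖x - y‖ₑ := by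
  wlog h : y ≤ x generalizing x y
  · simp_rw [enorm_sub_comm x y, ← this y x (le_of_not_ge h), enorm_sub_comm (step _ x)]
  have := step_sub_step_of_le' h
  simp_rw [fun t => congrFun this t, enorm_indicator_eq_indicator_enorm]
  rw [lintegral_indicator measurableSet_Ioc]
  simp [Real.enorm_eq_ofReal (sub_nonneg.2 h)]

theorem integral_mul_step_sub_step {s : ℝ → ℝ} (x y : ℝ) :
    ∫ t, s t * (step y t - step x t) = ∫ t in y..x, s t := by
  wlog h : y ≤ x generalizing x y
  · rw [intervalIntegral.integral_symm, ← this y x (le_of_not_ge h), ← integral_neg]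
    congr 1; ext t; ring
  have := step_sub_step_of_le h
  simp_rw [fun t => congrFun this t]
  rw [intervalIntegral.integral_of_le h, ← integral_Ico_eq_integral_Ioc,
    ← integral_indicator measurableSet_Ico]
  congr 1; ext t
  by_cases ht : t ∈ Set.Ico y x <;> simp [ht]

theorem integral_step (μ : Measure ℝ) [IsProbabilityMeasure μ] (t : ℝ) :
    ∫ x, step x t ∂μ = cdf μ t := by
  rw [cdf_eq_real]
  have : (fun x => step x t) = (Set.Iic t).indicator fun _ => (1 : ℝ) := by
    ext x; simp [step, Set.indicator]
  rw [this, integral_indicator measurableSet_Iic]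
  simp

theorem integrable_step (μ : Measure ℝ) [IsProbabilityMeasure μ] (t : ℝ) :
    Integrable (fun x => step x t) μ :=
  Integrable.of_bound (measurable_step measurable_id measurable_const).aestronglyMeasurable 1
    (ae_of_all _ fun x => norm_step_le x t)

theorem measurable_cdf (μ : Measure ℝ) : Measurable (cdf μ) := (monotone_cdf μ).measurable

/-- The quantile function. -/
noncomputable def quantile (μ : Measure ℝ) (u : ℝ) : ℝ := sInf {x | u ≤ cdf μ x}

/-- The limits of the distribution function at ±∞ make the defining set nonempty and bounded below
for 0 < u < 1; right continuity makes its infimum attained. Outside (0, 1) the quantile may be a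
junk value, hence the open interval in `unif`. -/
theorem quantile_le_iff (μ : Measure ℝ) {u : ℝ} (h0 : 0 < u) (h1 : u < 1) (x : ℝ) :
    quantile μ u ≤ x ↔ u ≤ cdf μ x := by
  have hne : {x | u ≤ cdf μ x}.Nonempty := by
    obtain ⟨y, hy⟩ := ((tendsto_cdf_atTop μ).eventually (eventually_gt_nhds h1)).exists
    exact ⟨y, hy.le⟩
  have hbdd : BddBelow {x | u ≤ cdf μ x} := by
    obtain ⟨y, hy⟩ := ((tendsto_cdf_atBot μ).eventually (eventually_lt_nhds h0)).exists
    refine ⟨y, fun z hz => ?_⟩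
    by_contra hc
    exact absurd (hz.trans (monotone_cdf μ (not_le.1 hc).le)) (not_le.2 hy)
  refine ⟨fun h => ?_, fun h => csInf_le hbdd h⟩
  have key : ∀ y, x < y → u ≤ cdf μ y := fun y hy => by
    obtain ⟨z, hz, hzy⟩ := exists_lt_of_csInf_lt hne (lt_of_le_of_lt h hy)
    exact le_trans hz (monotone_cdf μ hzy.le)
  have hlim : Tendsto (cdf μ) (𝓝[>] x) (𝓝 (cdf μ x)) :=
    ((cdf μ).right_continuous x).mono_left (nhdsWithin_mono _ Set.Ioi_subset_Ici_self)
  exact ge_of_tendsto hlim (by filter_upwards [self_mem_nhdsWithin] with y hy using key y hy)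

/-- The uniform law on `(0, 1)`. -/
noncomputable abbrev unif : Measure ℝ := volume.restrict (Set.Ioo 0 1)

theorem aemeasurable_quantile (μ : Measure ℝ) : AEMeasurable (quantile μ) unif := by
  refine aemeasurable_restrict_of_monotoneOn measurableSet_Ioo fun u hu v hv huv => ?_
  rw [quantile_le_iff μ hu.1 hu.2]
  exact huv.trans ((quantile_le_iff μ hv.1 hv.2 _).1 le_rfl)

theorem map_quantile (μ : Measure ℝ) [IsProbabilityMeasure μ] :
    unif.map (quantile μ) = μ := by
  have : IsFiniteMeasure (unif.map (quantile μ)) := by infer_instance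
  refine Measure.ext_of_Iic _ _ fun x => ?_
  rw [Measure.map_apply_of_aemeasurable (aemeasurable_quantile μ) measurableSet_Iic,
    Measure.restrict_apply₀', ← ofReal_cdf]
  swap
  · exact measurableSet_Ioo.nullMeasurableSet
  have h : quantile μ ⁻¹' Set.Iic x ∩ Set.Ioo 0 1 = Set.Ioc 0 (cdf μ x) ∩ Set.Ioo 0 1 := by
    ext u
    simp only [Set.mem_inter_iff, Set.mem_preimage, Set.mem_Iic, Set.mem_Ioo, Set.mem_Ioc]
    constructor
    · rintro ⟨h, h0, h1⟩; exact ⟨⟨h0, (quantile_le_iff μ h0 h1 x).1 h⟩, h0, h1⟩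
    · rintro ⟨h, h0, h1⟩; exact ⟨(quantile_le_iff μ h0 h1 x).2 h.2, h0, h1⟩
  rw [h]
  -- The set lies between (0, cdf x) and (0, cdf x], which have equal length; this also covers cdf x
  -- = 1, where the endpoint is lost.
  refine le_antisymm ((measure_mono Set.inter_subset_left).trans (by simp)) ?_
  refine le_trans (b := volume (Set.Ioo 0 (cdf μ x))) (by simp) (measure_mono fun u hu => ?_)
  exact ⟨⟨hu.1, hu.2.le⟩, hu.1, hu.2.trans_le (cdf_le_one μ x)⟩

/-- Under any coupling, |x − y| is the integral over t of |1{x ≤ t} − 1{y ≤ t}|; exchanging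
integrals and moving the absolute value outside the expectation leaves the distribution functions.
-/
theorem lintegral_enorm_cdf_sub_le (μ₁ μ₂ : Measure ℝ) [IsProbabilityMeasure μ₁]
    [IsProbabilityMeasure μ₂] :
    ∫⁻ t, ‖cdf μ₁ t - cdf μ₂ t‖ₑ ≤ d1 μ₁ μ₂ := by
  refine le_iInf fun π => le_iInf fun h1 => le_iInf fun h2 => ?_
  have : IsProbabilityMeasure π := by
    constructor
    have := congrArg (fun m => m Set.univ) h1
    simpa [Measure.map_apply measurable_fst] using this
  calc ∫⁻ t, ‖cdf μ₁ t - cdf μ₂ t‖ₑ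
      ≤ ∫⁻ t, ∫⁻ p, ‖step p.1 t - step p.2 t‖ₑ ∂π := by
        refine lintegral_mono fun t => ?_
        have e1 : cdf μ₁ t = ∫ p, step p.1 t ∂π := by
          rw [← integral_step, ← h1, integral_map measurable_fst.aemeasurable]
          exact (measurable_step measurable_id measurable_const).aestronglyMeasurable
        have e2 : cdf μ₂ t = ∫ p, step p.2 t ∂π := by
          rw [← integral_step, ← h2, integral_map measurable_snd.aemeasurable]
          exact (measurable_step measurable_id measurable_const).aestronglyMeasurable
        simp only
        rw [e1, e2, ← integral_sub]
        · exact enorm_integral_le_lintegral_enorm _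
        · exact Integrable.of_bound
            (measurable_step measurable_fst measurable_const).aestronglyMeasurable 1
            (ae_of_all _ fun x => norm_step_le _ t)
        · exact Integrable.of_bound
            (measurable_step measurable_snd measurable_const).aestronglyMeasurable 1
            (ae_of_all _ fun x => norm_step_le _ t)
    _ = ∫⁻ p, (∫⁻ t, ‖step p.1 t - step p.2 t‖ₑ) ∂π := by
        refine lintegral_lintegral_swap (Measurable.aemeasurable ?_)
        exact ((measurable_step (measurable_fst.comp measurable_snd) measurable_fst).sub
          (measurable_step (measurable_snd.comp measurable_snd) measurable_fst)).enorm
    _ = ∫⁻ p, ‖p.1 - p.2‖ₑ ∂π := by simp_rw [lintegral_enorm_step_sub_step]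

theorem d1_le_of_coupling {μ₁ μ₂ : Measure ℝ} (π : Measure (ℝ × ℝ)) (h1 : π.map Prod.fst = μ₁)
    (h2 : π.map Prod.snd = μ₂) : d1 μ₁ μ₂ ≤ ∫⁻ p, ‖p.1 - p.2‖ₑ ∂π :=
  iInf_le_of_le π (iInf_le_of_le h1 (iInf_le_of_le h2 le_rfl))

/-- The quantile coupling is optimal: by `quantile_le_iff` the indicators of {quantile ≤ t} are
indicators of {u ≤ cdf t}, and integrating them in u instead of t recovers |cdf₁ − cdf₂|. -/
theorem d1_eq_lintegral_cdf (μ₁ μ₂ : Measure ℝ) [IsProbabilityMeasure μ₁]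
    [IsProbabilityMeasure μ₂] :
    d1 μ₁ μ₂ = ∫⁻ t, ‖cdf μ₁ t - cdf μ₂ t‖ₑ := by
  refine le_antisymm ?_ (lintegral_enorm_cdf_sub_le μ₁ μ₂)
  have hm : AEMeasurable (fun u => (quantile μ₁ u, quantile μ₂ u)) unif :=
    (aemeasurable_quantile μ₁).prodMk (aemeasurable_quantile μ₂)
  refine (d1_le_of_coupling (unif.map fun u => (quantile μ₁ u, quantile μ₂ u)) ?_ ?_).trans ?_
  · rw [AEMeasurable.map_map_of_aemeasurable measurable_fst.aemeasurable hm]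
    exact map_quantile μ₁
  · rw [AEMeasurable.map_map_of_aemeasurable measurable_snd.aemeasurable hm]
    exact map_quantile μ₂
  rw [lintegral_map' (by fun_prop) hm]
  calc ∫⁻ u, ‖quantile μ₁ u - quantile μ₂ u‖ₑ ∂unif
      = ∫⁻ u, (∫⁻ t, ‖step u (cdf μ₁ t) - step u (cdf μ₂ t)‖ₑ) ∂unif := by
        refine setLIntegral_congr_fun measurableSet_Ioo fun u hu => ?_
        rw [← lintegral_enorm_step_sub_step]
        simp only [step, quantile_le_iff _ hu.1 hu.2]
    _ = ∫⁻ t, ∫⁻ u, ‖step u (cdf μ₁ t) - step u (cdf μ₂ t)‖ₑ ∂unif := by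
        refine lintegral_lintegral_swap (Measurable.aemeasurable ?_)
        exact ((measurable_step measurable_fst ((measurable_cdf μ₁).comp measurable_snd)).sub
          (measurable_step measurable_fst ((measurable_cdf μ₂).comp measurable_snd))).enorm
    _ ≤ ∫⁻ t, ∫⁻ u, ‖step u (cdf μ₁ t) - step u (cdf μ₂ t)‖ₑ :=
        lintegral_mono fun t => setLIntegral_le_lintegral _ _
    _ = ∫⁻ t, ‖cdf μ₁ t - cdf μ₂ t‖ₑ := by simp_rw [lintegral_enorm_step_sub_step']

/-- With the L¹ formula for distribution functions no gluing of couplings is required. -/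
theorem d1_triangle (μ₁ μ₂ μ₃ : Measure ℝ) [IsProbabilityMeasure μ₁] [IsProbabilityMeasure μ₂]
    [IsProbabilityMeasure μ₃] : d1 μ₁ μ₃ ≤ d1 μ₁ μ₂ + d1 μ₂ μ₃ := by
  simp_rw [d1_eq_lintegral_cdf]
  have hm : Measurable fun t => ‖cdf μ₁ t - cdf μ₂ t‖ₑ :=
    ((measurable_cdf μ₁).sub (measurable_cdf μ₂)).enorm
  rw [← lintegral_add_left hm]
  refine lintegral_mono fun t => ?_
  simpa using enorm_add_le (cdf μ₁ t - cdf μ₂ t) (cdf μ₂ t - cdf μ₃ t)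

theorem integrable_comp_of_lipschitz {α : Type*} [MeasurableSpace α] {μ : Measure α}
    [IsFiniteMeasure μ] {φ : ℝ → ℝ} (hφ : LipschitzWith 1 φ) {X : α → ℝ} (hX : Integrable X μ) :
    Integrable (fun x => φ (X x)) μ := by
  refine ((integrable_const |φ 0|).add hX.norm).mono'
    (hφ.continuous.comp_aestronglyMeasurable hX.1) (ae_of_all _ fun x => ?_)
  have h1 := hφ.dist_le_mul (X x) 0
  rw [Real.dist_eq, Real.dist_eq, NNReal.coe_one, one_mul, sub_zero] at h1
  have h2 := abs_sub_abs_le_abs_sub (φ (X x)) (φ 0)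
  simp only [Pi.add_apply, Real.norm_eq_abs]; linarith

/-- The extremal Lipschitz function is explicit: its slope is the sign of cdf₂ − cdf₁, so that
integration by parts, carried out here as Fubini on the product measure, yields exactly the L¹
distance of the distribution functions. -/
theorem d1_le_of_lipschitz (μ₁ μ₂ : Measure ℝ) [IsProbabilityMeasure μ₁]
    [IsProbabilityMeasure μ₂] (h1 : Integrable id μ₁) (h2 : Integrable id μ₂) {r : ℝ}
    (h : ∀ φ : ℝ → ℝ, LipschitzWith 1 φ → |∫ x, φ x ∂μ₁ - ∫ x, φ x ∂μ₂| ≤ r) :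
    d1 μ₁ μ₂ ≤ ENNReal.ofReal r := by
  rw [d1_eq_lintegral_cdf]
  set s : ℝ → ℝ := fun t => if cdf μ₁ t ≤ cdf μ₂ t then 1 else -1 with hs
  have hsm : Measurable s := Measurable.ite
    (measurableSet_le (measurable_cdf μ₁) (measurable_cdf μ₂)) measurable_const measurable_const
  have hs1 : ∀ t, ‖s t‖ = 1 := fun t => by
    simp only [hs]; split_ifs <;> simp
  have hsi : ∀ a b, IntervalIntegrable s volume a b := fun a b =>
    (intervalIntegrable_const (c := (1 : ℝ))).mono_fun hsm.aestronglyMeasurable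
      (ae_of_all _ fun t => by simp [hs1])
  set φ : ℝ → ℝ := fun x => ∫ t in 0..x, s t with hφ
  have hsub : ∀ x y, φ x - φ y = ∫ t, s t * (step y t - step x t) := fun x y => by
    rw [integral_mul_step_sub_step, hφ]
    exact intervalIntegral.integral_interval_sub_left (hsi _ _) (hsi _ _)
  have hlip : LipschitzWith 1 φ := by
    refine LipschitzWith.of_dist_le_mul fun x y => ?_
    rw [Real.dist_eq, hsub, integral_mul_step_sub_step, NNReal.coe_one, Real.dist_eq]
    exact intervalIntegral.norm_integral_le_of_norm_le_const fun t _ => (hs1 t).le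
  have hi1 : Integrable φ μ₁ := integrable_comp_of_lipschitz hlip h1
  have hi2 : Integrable φ μ₂ := integrable_comp_of_lipschitz hlip h2
  have hmeas : Measurable fun q : (ℝ × ℝ) × ℝ => s q.2 * (step q.1.2 q.2 - step q.1.1 q.2) :=
    (hsm.comp measurable_snd).mul ((measurable_step (by fun_prop) (by fun_prop)).sub
      (measurable_step (by fun_prop) (by fun_prop)))
  have hen : ∀ x y t, ‖s t * (step y t - step x t)‖ₑ = ‖step y t - step x t‖ₑ := fun x y t => by
    rw [enorm_mul, ← ofReal_norm (s t), hs1]; simp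
  have hint : Integrable (fun q : (ℝ × ℝ) × ℝ => s q.2 * (step q.1.2 q.2 - step q.1.1 q.2))
      ((μ₁.prod μ₂).prod volume) := by
    refine ⟨hmeas.aestronglyMeasurable, ?_⟩
    rw [hasFiniteIntegral_iff_enorm, lintegral_prod _ hmeas.enorm.aemeasurable]
    simp_rw [hen, lintegral_enorm_step_sub_step]
    have : Integrable (fun p : ℝ × ℝ => p.2 - p.1) (μ₁.prod μ₂) :=
      (h2.comp_snd μ₁).sub (h1.comp_fst μ₂)
    exact this.2
  have key : ∫ x, φ x ∂μ₁ - ∫ x, φ x ∂μ₂ = ∫ t, ‖cdf μ₁ t - cdf μ₂ t‖ := by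
    have e1 : ∫ x, φ x ∂μ₁ = ∫ p : ℝ × ℝ, φ p.1 ∂(μ₁.prod μ₂) := by
      simp [integral_fun_fst]
    have e2 : ∫ x, φ x ∂μ₂ = ∫ p : ℝ × ℝ, φ p.2 ∂(μ₁.prod μ₂) := by
      simp [integral_fun_snd]
    rw [e1, e2, ← integral_sub (hi1.comp_fst μ₂) (hi2.comp_snd μ₁)]
    simp_rw [hsub]
    rw [integral_integral_swap hint]
    congr 1; ext t
    rw [integral_const_mul, integral_sub ((integrable_step μ₂ t).comp_snd μ₁)
      ((integrable_step μ₁ t).comp_fst μ₂), integral_fun_fst (fun x => step x t),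
      integral_fun_snd (fun x => step x t), integral_step, integral_step]
    simp only [hs, probReal_univ, one_smul, Real.norm_eq_abs]
    split_ifs with hc
    · rw [abs_of_nonpos (by linarith)]; ring
    · rw [abs_of_pos (by linarith)]; ring
  -- Finiteness comes from the independent coupling, whose cost is finite by the first moments.
  have hcint : Integrable (fun t => cdf μ₁ t - cdf μ₂ t) := by
    refine ⟨((measurable_cdf μ₁).sub (measurable_cdf μ₂)).aestronglyMeasurable, ?_⟩
    rw [hasFiniteIntegral_iff_enorm]
    refine (lintegral_enorm_cdf_sub_le μ₁ μ₂).trans_lt ?_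
    refine lt_of_le_of_lt (d1_le_of_coupling (μ₁.prod μ₂)
      (by simp [Measure.map_fst_prod]) (by simp [Measure.map_snd_prod])) ?_
    have : Integrable (fun p : ℝ × ℝ => p.1 - p.2) (μ₁.prod μ₂) :=
      (h1.comp_fst μ₂).sub (h2.comp_snd μ₁)
    exact this.2
  have := h φ hlip
  rw [key] at this
  rw [← ofReal_integral_norm_eq_lintegral_enorm hcint]
  exact ENNReal.ofReal_le_ofReal ((le_abs_self _).trans this)

end RealTransport

/-! ### Gaussian integration by parts, Taylor bounds and smoothing. -/

namespace GaussianCalculus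

/-- The standard Gaussian law. -/
noncomputable abbrev γ : Measure ℝ := gaussianReal 0 1

theorem integrable_id_gaussian : Integrable (fun x : ℝ => x) γ :=
  (memLp_id_gaussianReal' 1 (by simp)).integrable le_rfl

theorem integrable_sq_gaussian : Integrable (fun x : ℝ => x ^ 2) γ :=
  (memLp_id_gaussianReal' 2 (by simp)).integrable_sq

theorem integral_sq_gaussian : ∫ x, x ^ 2 ∂γ = 1 := by
  have := variance_fun_id_gaussianReal (μ := 0) (v := 1)
  rw [variance_eq_integral (by fun_prop)] at this
  simpa [integral_id_gaussianReal] using this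

theorem integral_abs_gaussian : ∫ x, |x| ∂γ = Real.sqrt (2 / Real.pi) := by
  rw [integral_gaussianReal_eq_integral_smul one_ne_zero]
  have h : ∀ x : ℝ, gaussianPDFReal 0 1 x • |x|
      = (fun y => (√(2 * Real.pi))⁻¹ * (y ^ (1 : ℝ) * Real.exp (-(1 / 2) * y ^ (2 : ℝ)))) |x| :=
    fun x => by
      simp only [gaussianPDFReal_def, smul_eq_mul, NNReal.coe_one, mul_one, sub_zero,
        Real.rpow_one, Real.rpow_two, sq_abs]
      rw [show -x ^ 2 / 2 = -(1 / 2) * x ^ 2 by ring]; ring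
  simp_rw [h]
  rw [integral_comp_abs (f := fun y => (√(2 * Real.pi))⁻¹ *
    (y ^ (1 : ℝ) * Real.exp (-(1 / 2) * y ^ (2 : ℝ)))), integral_const_mul,
    integral_rpow_mul_exp_neg_mul_rpow (by norm_num) (by norm_num) (by norm_num)]
  norm_num
  have h2 : √2 * √2 = 2 := Real.mul_self_sqrt (by norm_num)
  have : 0 < √2 := by positivity
  have : 0 < √Real.pi := Real.sqrt_pos.2 Real.pi_pos
  field_simp
  nlinarith

theorem hasDerivAt_gaussianPDFReal (x : ℝ) :
    HasDerivAt (gaussianPDFReal 0 1) (-x * gaussianPDFReal 0 1 x) x := by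
  have h : HasDerivAt (fun x : ℝ => (√(2 * Real.pi))⁻¹ * Real.exp (-x ^ 2 / 2))
      ((√(2 * Real.pi))⁻¹ * (Real.exp (-x ^ 2 / 2) * (-(2 * x) / 2))) x := by
    have h1 : HasDerivAt (fun x : ℝ => -x ^ 2 / 2) (-(2 * x) / 2) x := by
      simpa using ((hasDerivAt_pow 2 x).neg.div_const 2)
    exact (h1.exp).const_mul _
  have e : gaussianPDFReal 0 1 = fun x : ℝ => (√(2 * Real.pi))⁻¹ * Real.exp (-x ^ 2 / 2) := by
    ext x; simp [gaussianPDFReal_def]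
  rw [e]
  convert h using 1; ring

theorem integrable_gaussian_iff {f : ℝ → ℝ} :
    Integrable f γ ↔ Integrable (fun x => f x * gaussianPDFReal 0 1 x) := by
  rw [γ, gaussianReal_of_var_ne_zero _ one_ne_zero,
    integrable_withDensity_iff (by fun_prop) (ae_of_all _ fun x => gaussianPDF_lt_top)]
  simp_rw [toReal_gaussianPDF]

theorem abs_le_of_hasDerivAt {f f' : ℝ → ℝ} {M : ℝ} (hf : ∀ x, HasDerivAt f (f' x) x)
    (hM : ∀ x, |f' x| ≤ M) (x y : ℝ) : |f x - f y| ≤ M * |x - y| := by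
  have := Convex.norm_image_sub_le_of_norm_hasDerivWithin_le (f := f) (f' := f') (C := M)
    (s := Set.univ) (fun z _ => (hf z).hasDerivWithinAt) (fun z _ => hM z) convex_univ
    (Set.mem_univ y) (Set.mem_univ x)
  simpa using this

/-- Gaussian integration by parts. -/
theorem integral_mul_gaussian {f f' : ℝ → ℝ} {M : ℝ} (hf : ∀ x, HasDerivAt f (f' x) x)
    (hf' : Measurable f') (hM : ∀ x, |f' x| ≤ M) :
    ∫ x, x * f x ∂γ = ∫ x, f' x ∂γ := by
  have hfc : Continuous f := continuous_iff_continuousAt.2 fun x => (hf x).continuousAt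
  have hgrow : ∀ x, |f x| ≤ |f 0| + M * |x| := fun x => by
    have h1 := abs_le_of_hasDerivAt hf hM x 0
    have h2 := abs_sub_abs_le_abs_sub (f x) (f 0)
    simp only [sub_zero] at h1; linarith
  have i0 : Integrable f γ :=
    ((integrable_const |f 0|).add (integrable_id_gaussian.norm.const_mul M)).mono'
      hfc.aestronglyMeasurable (ae_of_all _ fun x => by simpa using hgrow x)
  have i1 : Integrable (fun x => x * f x) γ := by
    refine ((integrable_id_gaussian.norm.const_mul |f 0|).add
      (integrable_sq_gaussian.const_mul M)).mono' (by fun_prop) (ae_of_all _ fun x => ?_)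
    have := mul_le_mul_of_nonneg_left (hgrow x) (abs_nonneg x)
    simp only [norm_mul, Real.norm_eq_abs, Pi.add_apply]
    calc |x| * |f x| ≤ _ := this
      _ = |f 0| * |x| + M * (|x| * |x|) := by ring
      _ = _ := by rw [abs_mul_abs_self]; ring
  have i2 : Integrable f' γ := Integrable.of_bound hf'.aestronglyMeasurable M
    (ae_of_all _ hM)
  have := integral_mul_deriv_eq_deriv_mul_of_integrable (u := f) (u' := f')
    (v := gaussianPDFReal 0 1) (v' := fun x => -x * gaussianPDFReal 0 1 x)
    (fun x _ => hf x) (fun x _ => hasDerivAt_gaussianPDFReal x)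
    (by
      refine (integrable_gaussian_iff.1 i1).neg.congr (ae_of_all _ fun x => ?_)
      simp only [Pi.neg_apply, Pi.mul_apply]; ring)
    (integrable_gaussian_iff.1 i2) (integrable_gaussian_iff.1 i0)
  rw [integral_gaussianReal_eq_integral_smul one_ne_zero,
    integral_gaussianReal_eq_integral_smul one_ne_zero]
  simp only [smul_eq_mul]
  calc ∫ x, gaussianPDFReal 0 1 x * (x * f x)
      = -∫ x, f x * (-x * gaussianPDFReal 0 1 x) := by
        rw [← integral_neg]; congr 1; ext x; ring
    _ = _ := by rw [this, neg_neg]; congr 1; ext x; ring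

theorem integral_mul_comp_affine_gaussian {f f' : ℝ → ℝ} {M : ℝ}
    (hf : ∀ x, HasDerivAt f (f' x) x) (hf' : Measurable f') (hM : ∀ x, |f' x| ≤ M) (a b : ℝ) :
    ∫ y, y * f (a + b * y) ∂γ = b * ∫ y, f' (a + b * y) ∂γ := by
  rw [integral_mul_gaussian (f := fun y => f (a + b * y)) (f' := fun y => f' (a + b * y) * b)
    (M := M * |b|) _ (by fun_prop) _, integral_mul_const, mul_comm]
  · intro y
    have : HasDerivAt (fun y => a + b * y) b y := by
      simpa using ((hasDerivAt_id y).const_mul b).const_add a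
    exact (hf _).comp y this
  · intro y
    rw [abs_mul]; exact mul_le_mul_of_nonneg_right (hM _) (abs_nonneg b)

/-- A substitute for integration by parts when `f` is merely Lipschitz: subtract the constant f(a),
which is free because E N = 0, then use E N² = 1. -/
theorem abs_integral_mul_comp_affine_gaussian_le {f : ℝ → ℝ} {L : ℝ} (hfc : Continuous f)
    (hL : ∀ x y, |f x - f y| ≤ L * |x - y|) (a b : ℝ) :
    |∫ y, y * f (a + b * y) ∂γ| ≤ L * |b| := by
  have i1 : Integrable (fun y => y * (f (a + b * y) - f a)) γ := by
    refine (integrable_sq_gaussian.const_mul (L * |b|)).mono' (by fun_prop)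
      (ae_of_all _ fun y => ?_)
    have := mul_le_mul_of_nonneg_left (hL (a + b * y) a) (abs_nonneg y)
    rw [add_sub_cancel_left, abs_mul] at this
    rw [norm_mul, Real.norm_eq_abs, Real.norm_eq_abs]
    calc _ ≤ _ := this
      _ = L * |b| * (|y| * |y|) := by ring
      _ = _ := by rw [abs_mul_abs_self]; ring
  have e : ∫ y, y * f (a + b * y) ∂γ = ∫ y, y * (f (a + b * y) - f a) ∂γ := by
    have : ∫ y, y * f a ∂γ = 0 := by
      rw [integral_mul_const, integral_id_gaussianReal, zero_mul]
    calc ∫ y, y * f (a + b * y) ∂γ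
        = ∫ y, (y * (f (a + b * y) - f a) + y * f a) ∂γ := by congr 1; ext y; ring
      _ = _ := by rw [integral_add i1 (integrable_id_gaussian.mul_const _), this, add_zero]
  rw [e]
  calc |∫ y, y * (f (a + b * y) - f a) ∂γ| ≤ ∫ y, |y * (f (a + b * y) - f a)| ∂γ :=
        abs_integral_le_integral_abs
    _ ≤ ∫ y, L * |b| * y ^ 2 ∂γ := by
        refine integral_mono i1.abs (integrable_sq_gaussian.const_mul _) fun y => ?_
        have := mul_le_mul_of_nonneg_left (hL (a + b * y) a) (abs_nonneg y)
        rw [add_sub_cancel_left, abs_mul] at this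
        simp only
        rw [abs_mul]
        calc _ ≤ _ := this
          _ = L * |b| * (|y| * |y|) := by ring
          _ = _ := by rw [abs_mul_abs_self]; ring
    _ = L * |b| := by rw [integral_const_mul, integral_sq_gaussian, mul_one]

/-- The first-order Taylor bound for a function whose derivative is Lipschitz. -/
theorem abs_taylor_le {f f' : ℝ → ℝ} {L : ℝ} (hf : ∀ x, HasDerivAt f (f' x) x)
    (hL : ∀ x y, |f' x - f' y| ≤ L * |x - y|) (x h : ℝ) :
    |f (x + h) - f x - f' x * h| ≤ L / 2 * h ^ 2 := by
  have hg : ∀ r : ℝ, HasDerivAt (fun r => f (x + r * h) - f x - f' x * (r * h))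
      ((f' (x + r * h) - f' x) * h) r := fun r => by
    have h1 : HasDerivAt (fun r : ℝ => r * h) h r := by
      simpa using (hasDerivAt_id r).mul_const h
    have h2 := (hf (x + r * h)).comp r (h1.const_add x)
    exact ((h2.sub_const (f x)).sub (h1.const_mul (f' x))).congr_deriv (by ring)
  have hB : ∀ r : ℝ, HasDerivAt (fun r => L / 2 * h ^ 2 * r ^ 2) (L * h ^ 2 * r) r := fun r => by
    exact ((hasDerivAt_pow 2 r).const_mul (L / 2 * h ^ 2)).congr_deriv (by norm_num; ring)
  have := image_norm_le_of_norm_deriv_right_le_deriv_boundary (a := 0) (b := 1)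
    (fun r _ => (hg r).continuousAt.continuousWithinAt) (fun r _ => (hg r).hasDerivWithinAt)
    (by simp) hB (fun r hr => by
      have := mul_le_mul_of_nonneg_right (hL (x + r * h) x) (abs_nonneg h)
      rw [add_sub_cancel_left, abs_mul, abs_of_nonneg hr.1] at this
      rw [norm_mul, Real.norm_eq_abs, Real.norm_eq_abs]
      calc _ ≤ _ := this
        _ = L * (|h| * |h|) * r := by ring
        _ = _ := by rw [abs_mul_abs_self]; ring) (Set.right_mem_Icc.2 zero_le_one)
  simpa using this

/-- Smoothing a Lipschitz function by the triangular kernel of width `σ`. -/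
theorem exists_smoothing {φ : ℝ → ℝ} (hφ : LipschitzWith 1 φ) {σ : ℝ} (hσ : 0 < σ) :
    ∃ ψ ψ' ψ'' : ℝ → ℝ, (∀ x, HasDerivAt ψ (ψ' x) x) ∧ (∀ x, HasDerivAt ψ' (ψ'' x) x) ∧
      (∀ x, |ψ'' x| ≤ 2 / σ) ∧ (∀ x y, |ψ'' x - ψ'' y| ≤ 4 / σ ^ 2 * |x - y|) ∧
      ∀ x, |ψ x - φ x| ≤ σ / 3 := by
  have hl : ∀ x y, |φ x - φ y| ≤ |x - y| := fun x y => by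
    simpa [Real.dist_eq] using hφ.dist_le_mul x y
  have hc := hφ.continuous
  set Φ' : ℝ → ℝ := fun x => ∫ t in 0..x, φ t
  have h1 : ∀ x, HasDerivAt Φ' (φ x) x := fun x => hc.integral_hasStrictDerivAt 0 x |>.hasDerivAt
  have hc1 : Continuous Φ' := continuous_iff_continuousAt.2 fun x => (h1 x).continuousAt
  set Φ : ℝ → ℝ := fun x => ∫ t in 0..x, Φ' t
  have h2 : ∀ x, HasDerivAt Φ (Φ' x) x := fun x => hc1.integral_hasStrictDerivAt 0 x |>.hasDerivAt
  -- Convolution with the triangular kernel is the second difference of a second primitive, divided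
  -- by σ². Differencing commutes with differentiation, so Φ, Φ', φ give ψ, ψ', ψ''.
  have hd : ∀ {g g' : ℝ → ℝ}, (∀ x, HasDerivAt g (g' x) x) → ∀ x,
      HasDerivAt (fun x => (g (x + σ) - 2 * g x + g (x - σ)) / σ ^ 2)
        ((g' (x + σ) - 2 * g' x + g' (x - σ)) / σ ^ 2) x := fun {g g'} hg x =>
    ((((hg (x + σ)).comp_add_const x σ).sub ((hg x).const_mul 2)).add
      ((hg (x - σ)).comp_sub_const x σ)).div_const _
  refine ⟨_, _, _, hd h2, hd h1, fun x => ?_, fun x y => ?_, fun x => ?_⟩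
  -- The second difference of φ is two increments of size at most σ each. Its Lipschitz constant,
  -- treated next, is 1 + 2 + 1 = 4.
  · rw [abs_div, abs_of_pos (by positivity : 0 < σ ^ 2), div_le_div_iff₀ (by positivity) hσ]
    have a1 := abs_le.1 (hl (x + σ) x)
    have a2 := abs_le.1 (hl (x - σ) x)
    rw [add_sub_cancel_left, abs_of_pos hσ] at a1
    rw [show x - σ - x = -σ by ring, abs_neg, abs_of_pos hσ] at a2
    have : |φ (x + σ) - 2 * φ x + φ (x - σ)| ≤ 2 * σ := abs_le.2 ⟨by linarith, by linarith⟩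
    nlinarith
  · rw [← sub_div, abs_div, abs_of_pos (by positivity : 0 < σ ^ 2), div_mul_eq_mul_div]
    refine div_le_div_of_nonneg_right ?_ (by positivity)
    have a1 := abs_le.1 (hl (x + σ) (y + σ))
    have a2 := abs_le.1 (hl (x - σ) (y - σ))
    have a3 := abs_le.1 (hl x y)
    rw [add_sub_add_right_eq_sub] at a1
    rw [sub_sub_sub_cancel_right] at a2
    exact abs_le.2 ⟨by linarith, by linarith⟩
  -- The error is integrated twice in the width r: starting from |φ(x + r) + φ(x − r) − 2φ(x)| ≤ 2r,
  -- it is at most r² and then r³/3. At r = σ, division by σ² leaves σ/3.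
  · have e1 : ∀ r : ℝ, HasDerivAt (fun r => Φ' (x + r) - Φ' (x - r) - 2 * r * φ x)
        (φ (x + r) + φ (x - r) - 2 * φ x) r := fun r => by
      exact ((((h1 (x + r)).comp_const_add x r).sub ((h1 (x - r)).comp_const_sub x r)).sub
        (((hasDerivAt_id r).const_mul 2).mul_const (φ x))).congr_deriv (by ring)
    have e2 : ∀ r : ℝ, HasDerivAt (fun r => Φ (x + r) - 2 * Φ x + Φ (x - r) - r ^ 2 * φ x)
        (Φ' (x + r) - Φ' (x - r) - 2 * r * φ x) r := fun r => by
      exact (((((h2 (x + r)).comp_const_add x r).sub_const (2 * Φ x)).add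
        ((h2 (x - r)).comp_const_sub x r)).sub
        ((hasDerivAt_pow 2 r).mul_const (φ x))).congr_deriv (by norm_num; ring)
    have b1 : ∀ r ∈ Set.Icc 0 σ, ‖Φ' (x + r) - Φ' (x - r) - 2 * r * φ x‖ ≤ r ^ 2 := by
      refine image_norm_le_of_norm_deriv_right_le_deriv_boundary (B' := fun r => 2 * r)
        (fun r _ => (e1 r).continuousAt.continuousWithinAt)
        (fun r _ => (e1 r).hasDerivWithinAt) (by simp) (fun r => ?_) (fun r hr => ?_)
      · simpa using hasDerivAt_pow 2 r
      · have a1 := abs_le.1 (hl (x + r) x)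
        have a2 := abs_le.1 (hl (x - r) x)
        rw [add_sub_cancel_left, abs_of_nonneg hr.1] at a1
        rw [show x - r - x = -r by ring, abs_neg, abs_of_nonneg hr.1] at a2
        exact abs_le.2 ⟨by linarith, by linarith⟩
    have b2 : ∀ r ∈ Set.Icc 0 σ, ‖Φ (x + r) - 2 * Φ x + Φ (x - r) - r ^ 2 * φ x‖ ≤ r ^ 3 / 3 := by
      refine image_norm_le_of_norm_deriv_right_le_deriv_boundary (B' := fun r => r ^ 2)
        (fun r _ => (e2 r).continuousAt.continuousWithinAt)
        (fun r _ => (e2 r).hasDerivWithinAt) (by simp; ring_nf) (fun r => ?_)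
        (fun r hr => b1 r ⟨hr.1, hr.2.le⟩)
      exact ((hasDerivAt_pow 3 r).div_const 3).congr_deriv (by norm_num)
    have := b2 σ ⟨hσ.le, le_rfl⟩
    rw [Real.norm_eq_abs] at this
    have e : (Φ (x + σ) - 2 * Φ x + Φ (x - σ)) / σ ^ 2 - φ x
        = (Φ (x + σ) - 2 * Φ x + Φ (x - σ) - σ ^ 2 * φ x) / σ ^ 2 := by
      field_simp
    rw [e, abs_div, abs_of_pos (by positivity : 0 < σ ^ 2), div_le_iff₀ (by positivity)]
    calc _ ≤ _ := this
      _ = _ := by ring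

end GaussianCalculus

/-! ### Duality and Gaussian averaging at a fixed point of the interpolation. -/

namespace PoissonSpace

open GaussianCalculus

theorem memLp_comp_of_lipschitz {α : Type*} [MeasurableSpace α] {μ : Measure α}
    [IsFiniteMeasure μ] {h : ℝ → ℝ} {a : ℝ} (ha : ∀ x y, |h x - h y| ≤ a * |x - y|)
    (hc : Continuous h) {X : α → ℝ} (hX : MemLp X 2 μ) : MemLp (fun x => h (X x)) 2 μ := by
  have h1 : MemLp (fun x => |h 0| + a * |X x|) 2 μ :=
    (memLp_const |h 0|).add (hX.norm.const_mul a)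
  refine h1.mono (hc.comp_aestronglyMeasurable hX.1) (ae_of_all _ fun x => ?_)
  have h2 := ha (X x) 0
  have h3 := abs_sub_abs_le_abs_sub (h (X x)) (h 0)
  rw [sub_zero] at h2
  exact le_trans (by rw [Real.norm_eq_abs]; linarith) (le_abs_self _)

theorem abs_integral_le_of_abs_le {α : Type*} [MeasurableSpace α] {μ : Measure α} {f g : α → ℝ}
    (hg : Integrable g μ) (h : ∀ x, |f x| ≤ g x) : |∫ x, f x ∂μ| ≤ ∫ x, g x ∂μ := by
  rw [← Real.norm_eq_abs]
  exact norm_integral_le_of_norm_le hg (ae_of_all _ h)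

theorem integral_add_add {α : Type*} [MeasurableSpace α] {μ : Measure α} {f g k : α → ℝ}
    (hf : Integrable f μ) (hg : Integrable g μ) (hk : Integrable k μ) :
    ∫ x, (f x + g x + k x) ∂μ = ∫ x, f x ∂μ + ∫ x, g x ∂μ + ∫ x, k x ∂μ := by
  have hfg : Integrable (fun x => f x + g x) μ := hf.add hg
  rw [integral_add hfg hk, integral_add hf hg]

theorem integrable_mul_of_memLp {α : Type*} [MeasurableSpace α] {μ : Measure α} {X Y : α → ℝ}
    (hX : MemLp X 2 μ) (hY : MemLp Y 2 μ) : Integrable (fun x => X x * Y x) μ :=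
  hX.integrable_mul hY

theorem integrable_mul_of_bounded {α : Type*} [MeasurableSpace α] {μ : Measure α} {X Y : α → ℝ}
    {a : ℝ} (hXm : AEStronglyMeasurable X μ) (ha : ∀ x, |X x| ≤ a) (hY : Integrable Y μ) :
    Integrable (fun x => X x * Y x) μ :=
  hY.bdd_mul hXm (ae_of_all _ ha)

theorem memLp_mul_gaussian {Ω : Type*} [MeasurableSpace Ω] {P : Measure Ω} [IsFiniteMeasure P]
    {X : Ω → ℝ} (hX : MemLp X 2 P) : MemLp (fun p : Ω × ℝ => X p.1 * p.2) 2 (P.prod γ) := by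
  have hm : AEStronglyMeasurable (fun p : Ω × ℝ => X p.1 * p.2) (P.prod γ) :=
    hX.1.comp_fst.mul measurable_snd.aestronglyMeasurable
  rw [memLp_two_iff_integrable_sq hm]
  simp_rw [mul_pow]
  exact hX.integrable_sq.mul_prod integrable_sq_gaussian

theorem integrable_bracket {Ω Z : Type*} [MeasurableSpace Ω] [MeasurableSpace Z]
    {P : Measure Ω} [SFinite P] {ν : Measure Z} [SigmaFinite ν] {η : Ω → PointMeasure Z}
    {F : PointMeasure Z → ℝ} {u : PointMeasure Z → Z → ℝ} (hu : MemDomDelta η P ν u) (hF : MemDomD η P ν F) :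
    Integrable (fun ω => bracket ν (u (η ω)) (addOp F (η ω))) P :=
  (integrable_mul_of_memLp hu.memLp hF.memLp_addOp).integral_prod_left

section Interpolation

variable {Ω Z : Type*} [MeasurableSpace Ω] [MeasurableSpace Z] {P : Measure Ω}
  [IsProbabilityMeasure P] {ν : Measure Z} {η : Ω → PointMeasure Z}
  {F S : PointMeasure Z → ℝ} {u : PointMeasure Z → Z → ℝ}

theorem addOp_comp (h : ℝ → ℝ) (α β : ℝ) (ξ : PointMeasure Z) (z : Z) :
    addOp (fun ξ => h (α * F ξ + β * S ξ)) ξ z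
      = h ((α * F ξ + β * S ξ) + (α * addOp F ξ z + β * addOp S ξ z))
        - h (α * F ξ + β * S ξ) := by
  rw [show α * F ξ + β * S ξ + (α * addOp F ξ z + β * addOp S ξ z)
    = α * F (addPoint ξ z) + β * S (addPoint ξ z) by unfold addOp; ring]
  rfl

/-- Makes h(αF + βS) an admissible test variable in the duality for δ; the Lipschitz bound dominates
its increments by those of F and S. -/
theorem MemDomD.comp (hF : MemDomD η P ν F) (hS : MemDomD η P ν S) {h : ℝ → ℝ} {a : ℝ}
    (ha : ∀ x y, |h x - h y| ≤ a * |x - y|) (hc : Continuous h) (α β : ℝ) :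
    MemDomD η P ν (fun ξ => h (α * F ξ + β * S ξ)) where
  measurable := hc.measurable.comp ((hF.measurable.const_mul α).add (hS.measurable.const_mul β))
  memLp := memLp_comp_of_lipschitz ha hc ((hF.memLp.const_mul α).add (hS.memLp.const_mul β))
  memLp_addOp := by
    simp_rw [addOp_comp]
    have hd : MemLp (fun p : Ω × Z => α * addOp F (η p.1) p.2 + β * addOp S (η p.1) p.2) 2
        (P.prod ν) := (hF.memLp_addOp.const_mul α).add (hS.memLp_addOp.const_mul β)
    have hX : AEStronglyMeasurable (fun p : Ω × Z => α * F (η p.1) + β * S (η p.1))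
        (P.prod ν) := ((hF.memLp.1.const_mul α).add (hS.memLp.1.const_mul β)).comp_fst
    refine (hd.norm.const_mul a).mono ((hc.comp_aestronglyMeasurable (hX.add hd.1)).sub
      (hc.comp_aestronglyMeasurable hX)) (ae_of_all _ fun p => ?_)
    refine le_trans ?_ (le_abs_self _)
    have := ha ((α * F (η p.1) + β * S (η p.1)) + (α * addOp F (η p.1) p.2
      + β * addOp S (η p.1) p.2)) (α * F (η p.1) + β * S (η p.1))
    rwa [add_sub_cancel_left] at this

theorem memLp_interpolation (hF : MemDomD η P ν F) (hS : MemDomD η P ν S) (s c : ℝ) :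
    MemLp (fun p : Ω × ℝ => s * F (η p.1) + c * (S (η p.1) * p.2)) 2 (P.prod γ) :=
  ((hF.memLp.comp_fst γ).const_mul s).add ((memLp_mul_gaussian hS.memLp).const_mul c)

theorem integral_S_mul_gaussian (hF : MemDomD η P ν F) (hS : MemDomD η P ν S)
    {h h' : ℝ → ℝ} {a : ℝ} (hh : ∀ x, HasDerivAt h (h' x) x)
    (ha : ∀ x, |h' x| ≤ a) (hc' : Continuous h') (s c : ℝ) :
    ∫ p : Ω × ℝ, h (s * F (η p.1) + c * (S (η p.1) * p.2)) * (S (η p.1) * p.2) ∂(P.prod γ)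
      = c * ∫ p : Ω × ℝ, h' (s * F (η p.1) + c * (S (η p.1) * p.2)) * S (η p.1) ^ 2
        ∂(P.prod γ) := by
  have hc : Continuous h := continuous_iff_continuousAt.2 fun x => (hh x).continuousAt
  have hX := memLp_interpolation hF hS s c
  have i1 := integrable_mul_of_memLp (memLp_comp_of_lipschitz (abs_le_of_hasDerivAt hh ha) hc hX)
    (memLp_mul_gaussian hS.memLp)
  have i2 := integrable_mul_of_bounded (hc'.comp_aestronglyMeasurable hX.1) (fun p => ha _)
    (hS.memLp.integrable_sq.comp_fst γ)
  rw [integral_prod _ i1, integral_prod _ i2, ← integral_const_mul]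
  congr 1; ext ω
  have := integral_mul_comp_affine_gaussian hh hc'.measurable ha (s * F (η ω)) (c * S (η ω))
  calc _ = S (η ω) * ∫ y, y * h (s * F (η ω) + c * S (η ω) * y) ∂γ := by
        rw [← integral_const_mul]; congr 1; ext y; rw [mul_assoc c]; ring
    _ = _ := by
        simp only
        rw [this, integral_mul_const]
        simp_rw [mul_assoc c]; ring

variable [SigmaFinite ν]

/-- Duality followed by a second-order Taylor expansion. -/
theorem abs_integral_sub_le (hF : MemDomD η P ν F) (hS : MemDomD η P ν S)
    (hu : IsDivergence η P ν u F) {h h' : ℝ → ℝ} {a L : ℝ} (hh : ∀ x, HasDerivAt h (h' x) x)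
    (ha : ∀ x, |h' x| ≤ a) (hc' : Continuous h') (hL : ∀ x y, |h' x - h' y| ≤ L * |x - y|)
    (hC : Integrable (fun p : Ω × Z => |u (η p.1) p.2| * addOp F (η p.1) p.2 ^ 2) (P.prod ν))
    (hE : Integrable (fun p : Ω × Z => |u (η p.1) p.2| * addOp S (η p.1) p.2 ^ 2) (P.prod ν))
    (α β : ℝ) :
    |∫ ω, h (α * F (η ω) + β * S (η ω)) * F (η ω) ∂P
      - ∫ ω, h' (α * F (η ω) + β * S (η ω)) * (α * bracket ν (u (η ω)) (addOp F (η ω))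
          + β * bracket ν (u (η ω)) (addOp S (η ω))) ∂P|
      ≤ L / 2 * (α ^ 2 * ∫ p : Ω × Z, |u (η p.1) p.2| * addOp F (η p.1) p.2 ^ 2 ∂(P.prod ν)
        + 2 * α * β * ∫ p : Ω × Z, |u (η p.1) p.2| *
            (addOp F (η p.1) p.2 * addOp S (η p.1) p.2) ∂(P.prod ν)
        + β ^ 2 * ∫ p : Ω × Z, |u (η p.1) p.2| * addOp S (η p.1) p.2 ^ 2 ∂(P.prod ν)) := by
  have hc : Continuous h := continuous_iff_continuousAt.2 fun x => (hh x).continuousAt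
  have hG := hF.comp hS (abs_le_of_hasDerivAt hh ha) hc α β
  rw [hu.duality _ hG, pairing]
  have iG := integrable_mul_of_memLp hu.mem_dom.memLp hG.memLp_addOp
  have iF := integrable_mul_of_memLp hu.mem_dom.memLp hF.memLp_addOp
  have iS := integrable_mul_of_memLp hu.mem_dom.memLp hS.memLp_addOp
  have hX : AEStronglyMeasurable (fun p : Ω × Z => α * F (η p.1) + β * S (η p.1))
      (P.prod ν) := ((hF.memLp.1.const_mul α).add (hS.memLp.1.const_mul β)).comp_fst
  have iM : Integrable (fun p : Ω × Z => h' (α * F (η p.1) + β * S (η p.1)) *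
      (α * (u (η p.1) p.2 * addOp F (η p.1) p.2) + β * (u (η p.1) p.2 * addOp S (η p.1) p.2)))
      (P.prod ν) :=
    integrable_mul_of_bounded (hc'.comp_aestronglyMeasurable hX) (fun p => ha _)
      ((iF.const_mul α).add (iS.const_mul β))
  -- The cross term is dominated by the two squares. It is kept explicit, not absorbed into them,
  -- since it will vanish once β is made a multiple of N and averaged.
  have iK : Integrable (fun p : Ω × Z => |u (η p.1) p.2| *
      (addOp F (η p.1) p.2 * addOp S (η p.1) p.2)) (P.prod ν) := by
    refine (hC.add hE).mono' (hu.mem_dom.memLp.1.norm.mul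
      (hF.memLp_addOp.1.mul hS.memLp_addOp.1)) (ae_of_all _ fun p => ?_)
    simp only [Pi.add_apply]
    simp only [Real.norm_eq_abs, abs_mul, abs_abs]
    rw [← mul_add]
    refine mul_le_mul_of_nonneg_left ?_ (abs_nonneg _)
    rw [← sq_abs (addOp F _ _), ← sq_abs (addOp S _ _)]
    nlinarith [sq_nonneg (|addOp F (η p.1) p.2| - |addOp S (η p.1) p.2|),
      sq_nonneg |addOp F (η p.1) p.2|, sq_nonneg |addOp S (η p.1) p.2|]
  have e1 : ∫ ω, ∫ z, u (η ω) z * addOp (fun ξ => h (α * F ξ + β * S ξ)) (η ω) z ∂ν ∂P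
      = ∫ p : Ω × Z, u (η p.1) p.2 * addOp (fun ξ => h (α * F ξ + β * S ξ)) (η p.1) p.2
        ∂(P.prod ν) := (integral_prod _ iG).symm
  have e2 : ∫ ω, h' (α * F (η ω) + β * S (η ω)) * (α * bracket ν (u (η ω)) (addOp F (η ω))
          + β * bracket ν (u (η ω)) (addOp S (η ω))) ∂P
      = ∫ p : Ω × Z, h' (α * F (η p.1) + β * S (η p.1)) *
      (α * (u (η p.1) p.2 * addOp F (η p.1) p.2) + β * (u (η p.1) p.2 * addOp S (η p.1) p.2))
        ∂(P.prod ν) := by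
    rw [integral_prod _ iM]
    refine integral_congr_ae ?_
    filter_upwards [iF.prod_right_ae, iS.prod_right_ae] with ω h1 h2
    rw [integral_const_mul, integral_add (h1.const_mul α) (h2.const_mul β), integral_const_mul,
      integral_const_mul]
    rfl
  rw [e1, e2, ← integral_sub iG iM]
  have iB : Integrable (fun p : Ω × Z => L / 2 * (α ^ 2 * (|u (η p.1) p.2| *
      addOp F (η p.1) p.2 ^ 2) + 2 * α * β * (|u (η p.1) p.2| *
            (addOp F (η p.1) p.2 * addOp S (η p.1) p.2))
        + β ^ 2 * (|u (η p.1) p.2| * addOp S (η p.1) p.2 ^ 2))) (P.prod ν) :=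
    (((hC.const_mul _).add (iK.const_mul _)).add (hE.const_mul _)).const_mul _
  refine (abs_integral_le_of_abs_le iB fun p => ?_).trans_eq ?_
  · have := mul_le_mul_of_nonneg_left (abs_taylor_le hh hL (α * F (η p.1) + β * S (η p.1))
      (α * addOp F (η p.1) p.2 + β * addOp S (η p.1) p.2)) (abs_nonneg (u (η p.1) p.2))
    rw [← abs_mul] at this
    rw [addOp_comp]
    refine (le_of_eq ?_).trans (this.trans_eq ?_)
    · congr 1; ring
    · ring
  · rw [integral_const_mul, integral_add_add (hC.const_mul _) (iK.const_mul _) (hE.const_mul _),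
      integral_const_mul, integral_const_mul, integral_const_mul]

/-- Duality is applied for each frozen value y of N, with α = s and β = c y. Averaging the remainder
over N then kills the cross term (E N = 0) and turns y² into 1. -/
theorem abs_integral_F_sub_le (hF : MemDomD η P ν F) (hS : MemDomD η P ν S)
    (hu : IsDivergence η P ν u F) {h h' : ℝ → ℝ} {a L : ℝ} (hh : ∀ x, HasDerivAt h (h' x) x)
    (ha : ∀ x, |h' x| ≤ a) (hc' : Continuous h') (hL : ∀ x y, |h' x - h' y| ≤ L * |x - y|)
    (hC : Integrable (fun p : Ω × Z => |u (η p.1) p.2| * addOp F (η p.1) p.2 ^ 2) (P.prod ν))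
    (hE : Integrable (fun p : Ω × Z => |u (η p.1) p.2| * addOp S (η p.1) p.2 ^ 2) (P.prod ν))
    (hB : Integrable (fun ω => |S (η ω) * bracket ν (u (η ω)) (addOp S (η ω))|) P)
    (s c : ℝ) :
    |∫ p : Ω × ℝ, h (s * F (η p.1) + c * (S (η p.1) * p.2)) * F (η p.1) ∂(P.prod γ)
      - s * ∫ p : Ω × ℝ, h' (s * F (η p.1) + c * (S (η p.1) * p.2)) *
          bracket ν (u (η p.1)) (addOp F (η p.1)) ∂(P.prod γ)|
      ≤ c ^ 2 * L * ∫ ω, |S (η ω) * bracket ν (u (η ω)) (addOp S (η ω))| ∂P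
        + L / 2 * (s ^ 2 * ∫ p : Ω × Z, |u (η p.1) p.2| * addOp F (η p.1) p.2 ^ 2 ∂(P.prod ν)
        + c ^ 2 * ∫ p : Ω × Z, |u (η p.1) p.2| * addOp S (η p.1) p.2 ^ 2 ∂(P.prod ν)) := by
  have hc : Continuous h := continuous_iff_continuousAt.2 fun x => (hh x).continuousAt
  have hX := memLp_interpolation hF hS s c
  have i1 : Integrable (fun p : Ω × ℝ => h (s * F (η p.1) + c * (S (η p.1) * p.2)) * F (η p.1))
      (P.prod γ) :=
    integrable_mul_of_memLp (memLp_comp_of_lipschitz (abs_le_of_hasDerivAt hh ha) hc hX)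
      (hF.memLp.comp_fst γ)
  have hm := hc'.comp_aestronglyMeasurable hX.1
  have i2 : Integrable (fun p : Ω × ℝ => h' (s * F (η p.1) + c * (S (η p.1) * p.2)) *
      bracket ν (u (η p.1)) (addOp F (η p.1))) (P.prod γ) :=
    integrable_mul_of_bounded hm (fun p => ha _) ((integrable_bracket hu.mem_dom hF).comp_fst γ)
  have i3 : Integrable (fun p : Ω × ℝ => h' (s * F (η p.1) + c * (S (η p.1) * p.2)) *
      (bracket ν (u (η p.1)) (addOp S (η p.1)) * p.2)) (P.prod γ) :=
    integrable_mul_of_bounded hm (fun p => ha _)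
      ((integrable_bracket hu.mem_dom hS).mul_prod integrable_id_gaussian)
  -- For fixed ω the argument of `h'` has slope c S in y, so the Lipschitz bound for Gaussian
  -- averages produces |c| L |S|. This is where S ν(u DS) comes from.
  have hT : |∫ p : Ω × ℝ, h' (s * F (η p.1) + c * (S (η p.1) * p.2)) *
      (bracket ν (u (η p.1)) (addOp S (η p.1)) * p.2) ∂(P.prod γ)|
      ≤ |c| * L * ∫ ω, |S (η ω) * bracket ν (u (η ω)) (addOp S (η ω))| ∂P := by
    rw [integral_prod _ i3, ← integral_const_mul]
    refine abs_integral_le_of_abs_le (hB.const_mul _) fun ω => ?_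
    have e : ∫ y, h' (s * F (η ω) + c * (S (η ω) * y)) *
        (bracket ν (u (η ω)) (addOp S (η ω)) * y) ∂γ
        = bracket ν (u (η ω)) (addOp S (η ω)) *
          ∫ y, y * h' (s * F (η ω) + (c * S (η ω)) * y) ∂γ := by
      rw [← integral_const_mul]
      congr 1; ext y; rw [mul_assoc c]; ring
    simp only
    rw [e, abs_mul]
    refine (mul_le_mul_of_nonneg_left (abs_integral_mul_comp_affine_gaussian_le hc' hL _ _)
      (abs_nonneg _)).trans_eq ?_
    rw [abs_mul, abs_mul]; ring
  set C := ∫ p : Ω × Z, |u (η p.1) p.2| * addOp F (η p.1) p.2 ^ 2 ∂(P.prod ν)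
  set E := ∫ p : Ω × Z, |u (η p.1) p.2| * addOp S (η p.1) p.2 ^ 2 ∂(P.prod ν)
  set B := ∫ ω, |S (η ω) * bracket ν (u (η ω)) (addOp S (η ω))| ∂P
  set K := ∫ p : Ω × Z, |u (η p.1) p.2| *
            (addOp F (η p.1) p.2 * addOp S (η p.1) p.2) ∂(P.prod ν)
  have hR : |∫ p : Ω × ℝ, h (s * F (η p.1) + c * (S (η p.1) * p.2)) * F (η p.1) ∂(P.prod γ)
      - ∫ p : Ω × ℝ, (s * (h' (s * F (η p.1) + c * (S (η p.1) * p.2)) *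
          bracket ν (u (η p.1)) (addOp F (η p.1)))
          + c * (h' (s * F (η p.1) + c * (S (η p.1) * p.2)) *
      (bracket ν (u (η p.1)) (addOp S (η p.1)) * p.2))) ∂(P.prod γ)|
      ≤ L / 2 * (s ^ 2 * C + c ^ 2 * E) := by
    have i4 : Integrable (fun p : Ω × ℝ => s * (h' (s * F (η p.1) + c * (S (η p.1) * p.2)) *
          bracket ν (u (η p.1)) (addOp F (η p.1)))
          + c * (h' (s * F (η p.1) + c * (S (η p.1) * p.2)) *
      (bracket ν (u (η p.1)) (addOp S (η p.1)) * p.2))) (P.prod γ) :=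
      (i2.const_mul s).add (i3.const_mul c)
    rw [integral_prod_symm _ i1, integral_prod_symm _ i4,
      ← integral_sub i1.integral_prod_right i4.integral_prod_right]
    have iB : Integrable (fun y : ℝ => L / 2 * s ^ 2 * C + L * s * c * K * y
        + L / 2 * c ^ 2 * E * y ^ 2) γ :=
      ((integrable_const _).add (integrable_id_gaussian.const_mul _)).add
        (integrable_sq_gaussian.const_mul _)
    refine (abs_integral_le_of_abs_le iB fun y => ?_).trans_eq ?_
    · have := abs_integral_sub_le hF hS hu hh ha hc' hL hC hE s (c * y)
      refine (le_of_eq ?_).trans (this.trans_eq (by ring))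
      congr 2
      · congr 1; ext ω
        rw [show c * (S (η ω) * y) = c * y * S (η ω) by ring]
      · congr 1; ext ω
        rw [show c * (S (η ω) * y) = c * y * S (η ω) by ring]; ring
    · rw [integral_add_add (integrable_const _) (integrable_id_gaussian.const_mul _)
        (integrable_sq_gaussian.const_mul _), integral_const, integral_const_mul, integral_const_mul,
        integral_sq_gaussian, integral_id_gaussianReal]
      simp; ring
  rw [integral_add (i2.const_mul s) (i3.const_mul c), integral_const_mul, integral_const_mul] at hR
  have h1 := abs_le.1 hR
  have h2 : |c * ∫ p : Ω × ℝ, h' (s * F (η p.1) + c * (S (η p.1) * p.2)) *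
      (bracket ν (u (η p.1)) (addOp S (η p.1)) * p.2) ∂(P.prod γ)| ≤ c ^ 2 * L * B := by
    rw [abs_mul]
    refine (mul_le_mul_of_nonneg_left hT (abs_nonneg c)).trans_eq ?_
    rw [← sq_abs c]; ring
  have h3 := abs_le.1 h2
  exact abs_le.2 ⟨by linarith, by linarith⟩

end Interpolation

end PoissonSpace

/-! ### Integration along the interpolation path. -/

namespace PoissonSpace

open GaussianCalculus

section Interpolation

variable {Ω Z : Type*} [MeasurableSpace Ω] [MeasurableSpace Z] {P : Measure Ω}
  [IsProbabilityMeasure P] {ν : Measure Z} [SigmaFinite ν] {η : Ω → PointMeasure Z}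
  {F S : PointMeasure Z → ℝ} {u : PointMeasure Z → Z → ℝ}

/-- The factor c of F and the slope s in duality give s c h' S²; the factor s of S N and the slope c
in Gaussian integration by parts give the same quantity, and the two cancel. -/
theorem abs_integral_deriv_interpolation_le (hF : MemDomD η P ν F) (hS : MemDomD η P ν S)
    (hu : IsDivergence η P ν u F) {h h' : ℝ → ℝ} {a L : ℝ} (hh : ∀ x, HasDerivAt h (h' x) x)
    (ha : ∀ x, |h' x| ≤ a) (hc' : Continuous h') (hL : ∀ x y, |h' x - h' y| ≤ L * |x - y|)
    (hC : Integrable (fun p : Ω × Z => |u (η p.1) p.2| * addOp F (η p.1) p.2 ^ 2) (P.prod ν))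
    (hE : Integrable (fun p : Ω × Z => |u (η p.1) p.2| * addOp S (η p.1) p.2 ^ 2) (P.prod ν))
    (hB : Integrable (fun ω => |S (η ω) * bracket ν (u (η ω)) (addOp S (η ω))|) P)
    {e : Ω → ℝ} (he : Integrable e P)
    (hdec : ∀ᵐ ω ∂P, bracket ν (u (η ω)) (addOp F (η ω)) = S (η ω) ^ 2 + e ω)
    {s c : ℝ} (hs : 0 ≤ s) (hc : 0 ≤ c) :
    |∫ p : Ω × ℝ, h (s * F (η p.1) + c * (S (η p.1) * p.2)) *
        (c * F (η p.1) - s * (S (η p.1) * p.2)) ∂(P.prod γ)|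
      ≤ s * c * a * ∫ ω, |e ω| ∂P
        + c * (c ^ 2 * L * ∫ ω, |S (η ω) * bracket ν (u (η ω)) (addOp S (η ω))| ∂P
        + L / 2 * (s ^ 2 * ∫ p : Ω × Z, |u (η p.1) p.2| * addOp F (η p.1) p.2 ^ 2 ∂(P.prod ν)
        + c ^ 2 * ∫ p : Ω × Z, |u (η p.1) p.2| * addOp S (η p.1) p.2 ^ 2 ∂(P.prod ν))) := by
  have hcont : Continuous h := continuous_iff_continuousAt.2 fun x => (hh x).continuousAt
  have hX := memLp_interpolation hF hS s c
  have hhX := memLp_comp_of_lipschitz (abs_le_of_hasDerivAt hh ha) hcont hX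
  have hm := hc'.comp_aestronglyMeasurable hX.1
  have i1 := integrable_mul_of_memLp hhX (hF.memLp.comp_fst γ)
  have i2 := integrable_mul_of_memLp hhX (memLp_mul_gaussian hS.memLp)
  have i3 := integrable_mul_of_bounded hm (fun p => ha _) (hS.memLp.integrable_sq.comp_fst γ)
  have i4 := integrable_mul_of_bounded hm (fun p => ha _) (he.comp_fst γ)
  have e0 : ∫ p : Ω × ℝ, h (s * F (η p.1) + c * (S (η p.1) * p.2)) *
        (c * F (η p.1) - s * (S (η p.1) * p.2)) ∂(P.prod γ)
      = c * ∫ p : Ω × ℝ, h (s * F (η p.1) + c * (S (η p.1) * p.2)) * F (η p.1) ∂(P.prod γ)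
        - s * ∫ p : Ω × ℝ, h (s * F (η p.1) + c * (S (η p.1) * p.2)) * (S (η p.1) * p.2)
          ∂(P.prod γ) := by
    rw [← integral_const_mul, ← integral_const_mul,
      ← integral_sub (i1.const_mul c) (i2.const_mul s)]
    congr 1; ext p; ring
  have e1 : ∫ p : Ω × ℝ, h' (s * F (η p.1) + c * (S (η p.1) * p.2)) *
          bracket ν (u (η p.1)) (addOp F (η p.1)) ∂(P.prod γ)
      = ∫ p : Ω × ℝ, h' (s * F (η p.1) + c * (S (η p.1) * p.2)) * S (η p.1) ^ 2 ∂(P.prod γ)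
        + ∫ p : Ω × ℝ, h' (s * F (η p.1) + c * (S (η p.1) * p.2)) * e p.1 ∂(P.prod γ) := by
    rw [← integral_add i3 i4]
    refine integral_congr_ae ?_
    filter_upwards [Measure.quasiMeasurePreserving_fst.ae hdec] with p hp
    rw [hp]; ring
  have b1 : |∫ p : Ω × ℝ, h' (s * F (η p.1) + c * (S (η p.1) * p.2)) * e p.1 ∂(P.prod γ)|
      ≤ a * ∫ ω, |e ω| ∂P := by
    have : ∫ p : Ω × ℝ, a * |e p.1| ∂(P.prod γ) = a * ∫ ω, |e ω| ∂P := by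
      rw [integral_const_mul, integral_fun_fst (fun ω => |e ω|)]; simp
    rw [← this]
    refine abs_integral_le_of_abs_le ((he.abs.comp_fst γ).const_mul a) fun p => ?_
    rw [abs_mul]
    exact mul_le_mul_of_nonneg_right (ha _) (abs_nonneg _)
  have b2 := abs_integral_F_sub_le hF hS hu hh ha hc' hL hC hE hB s c
  rw [e1] at b2
  rw [e0, integral_S_mul_gaussian hF hS hh ha hc']
  have c1 := abs_le.1 b1
  have c2 := abs_le.1 b2
  have m1 := mul_le_mul_of_nonneg_left c1.1 (mul_nonneg hs hc)
  have m2 := mul_le_mul_of_nonneg_left c1.2 (mul_nonneg hs hc)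
  have m3 := mul_le_mul_of_nonneg_left c2.1 hc
  have m4 := mul_le_mul_of_nonneg_left c2.2 hc
  exact abs_le.2 ⟨by linarith, by linarith⟩

theorem integrable_comp_of_memLp {α : Type*} [MeasurableSpace α] {μ : Measure α}
    [IsFiniteMeasure μ] {f f' : ℝ → ℝ} {a : ℝ} (hf : ∀ x, HasDerivAt f (f' x) x)
    (ha : ∀ x y, |f' x - f' y| ≤ a * |x - y|) {X : α → ℝ} (hX : MemLp X 2 μ) :
    Integrable (fun x => f (X x)) μ := by
  have hc : Continuous f := continuous_iff_continuousAt.2 fun x => (hf x).continuousAt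
  have h1 : Integrable X μ := hX.integrable one_le_two
  have h2 : Integrable (fun x => |f 0| + |f' 0| * |X x| + a / 2 * X x ^ 2) μ :=
    ((integrable_const _).add (h1.abs.const_mul _)).add (hX.integrable_sq.const_mul _)
  refine h2.mono' (hc.comp_aestronglyMeasurable hX.1) (ae_of_all _ fun x => ?_)
  have h3 := abs_taylor_le hf ha 0 (X x)
  rw [zero_add] at h3
  rw [← abs_mul, Real.norm_eq_abs]
  have := abs_add_three (f (X x) - f 0 - f' 0 * X x) (f 0) (f' 0 * X x)
  rw [show f (X x) - f 0 - f' 0 * X x + f 0 + f' 0 * X x = f (X x) by ring] at this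
  linarith

theorem abs_integral_test_sub_le (hF : MemDomD η P ν F) (hS : MemDomD η P ν S)
    (hu : IsDivergence η P ν u F) {f h h' : ℝ → ℝ} {a L : ℝ} (hf : ∀ x, HasDerivAt f (h x) x)
    (hh : ∀ x, HasDerivAt h (h' x) x)
    (ha : ∀ x, |h' x| ≤ a) (hL : ∀ x y, |h' x - h' y| ≤ L * |x - y|)
    (hC : Integrable (fun p : Ω × Z => |u (η p.1) p.2| * addOp F (η p.1) p.2 ^ 2) (P.prod ν))
    (hE : Integrable (fun p : Ω × Z => |u (η p.1) p.2| * addOp S (η p.1) p.2 ^ 2) (P.prod ν))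
    (hB : Integrable (fun ω => |S (η ω) * bracket ν (u (η ω)) (addOp S (η ω))|) P)
    {e : Ω → ℝ} (he : Integrable e P)
    (hdec : ∀ᵐ ω ∂P, bracket ν (u (η ω)) (addOp F (η ω)) = S (η ω) ^ 2 + e ω) :
    |∫ ω, f (F (η ω)) ∂P - ∫ p : Ω × ℝ, f (S (η p.1) * p.2) ∂(P.prod γ)|
      ≤ a / 2 * ∫ ω, |e ω| ∂P
        + L * (2 / 3 * ∫ ω, |S (η ω) * bracket ν (u (η ω)) (addOp S (η ω))| ∂P
        + 1 / 6 * ∫ p : Ω × Z, |u (η p.1) p.2| * addOp F (η p.1) p.2 ^ 2 ∂(P.prod ν)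
        + 1 / 3 * ∫ p : Ω × Z, |u (η p.1) p.2| * addOp S (η p.1) p.2 ^ 2 ∂(P.prod ν)) := by
  have hc' : Continuous h' := by
    refine (LipschitzWith.of_dist_le_mul (K := L.toNNReal) fun x y => ?_).continuous
    rw [Real.dist_eq, Real.dist_eq]
    exact (hL x y).trans (mul_le_mul_of_nonneg_right (Real.le_coe_toNNReal L) (abs_nonneg _))
  have hcont : Continuous h := continuous_iff_continuousAt.2 fun x => (hh x).continuousAt
  have hfcont : Continuous f := continuous_iff_continuousAt.2 fun x => (hf x).continuousAt
  have hlip := abs_le_of_hasDerivAt hh ha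
  have hFQ := hF.memLp.comp_fst (γ)
  have hSQ := memLp_mul_gaussian hS.memLp
  set A := ∫ ω, |e ω| ∂P
  set B := ∫ ω, |S (η ω) * bracket ν (u (η ω)) (addOp S (η ω))| ∂P with hBdef
  set C := ∫ p : Ω × Z, |u (η p.1) p.2| * addOp F (η p.1) p.2 ^ 2 ∂(P.prod ν) with hCdef
  set E := ∫ p : Ω × Z, |u (η p.1) p.2| * addOp S (η p.1) p.2 ^ 2 ∂(P.prod ν) with hEdef
  set g : ℝ → ℝ := fun θ => ∫ p : Ω × ℝ,
    f (Real.sin θ * F (η p.1) + Real.cos θ * (S (η p.1) * p.2)) ∂(P.prod γ) with hg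
  have hX : ∀ θ : ℝ, MemLp (fun p : Ω × ℝ => Real.sin θ * F (η p.1)
      + Real.cos θ * (S (η p.1) * p.2)) 2 (P.prod γ) :=
    fun θ => memLp_interpolation hF hS _ _
  -- A dominating function uniform in θ, from |sin|, |cos| ≤ 1 and the linear growth of `h`.
  have hbd : Integrable (fun p : Ω × ℝ => (|h 0| + a * (|F (η p.1)| + |S (η p.1) * p.2|)) *
      (|F (η p.1)| + |S (η p.1) * p.2|)) (P.prod γ) :=
    integrable_mul_of_memLp ((memLp_const |h 0|).add ((hFQ.norm.add hSQ.norm).const_mul a))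
      (hFQ.norm.add hSQ.norm)
  have a0 : 0 ≤ a := (abs_nonneg _).trans (ha 0)
  have hderiv : ∀ θ, HasDerivAt g (∫ p : Ω × ℝ,
      h (Real.sin θ * F (η p.1) + Real.cos θ * (S (η p.1) * p.2)) *
        (Real.cos θ * F (η p.1) - Real.sin θ * (S (η p.1) * p.2)) ∂(P.prod γ)) θ := by
    intro θ
    refine (hasDerivAt_integral_of_dominated_loc_of_deriv_le (s := Set.univ)
      (F := fun θ (p : Ω × ℝ) => f (Real.sin θ * F (η p.1) + Real.cos θ * (S (η p.1) * p.2)))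
      (F' := fun θ (p : Ω × ℝ) => h (Real.sin θ * F (η p.1) + Real.cos θ * (S (η p.1) * p.2)) *
        (Real.cos θ * F (η p.1) - Real.sin θ * (S (η p.1) * p.2)))
      Filter.univ_mem ?_ ?_ ?_ ?_ hbd ?_).2
    · exact Eventually.of_forall fun θ => hfcont.comp_aestronglyMeasurable (hX θ).1
    · exact integrable_comp_of_memLp hf hlip (hX θ)
    · exact (hcont.comp_aestronglyMeasurable (hX θ).1).mul
        ((hFQ.1.const_mul _).sub (hSQ.1.const_mul _))
    · refine ae_of_all _ fun p θ _ => ?_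
      have s1 := Real.abs_sin_le_one θ
      have c1 := Real.abs_cos_le_one θ
      rw [norm_mul, Real.norm_eq_abs, Real.norm_eq_abs]
      have k1 : |Real.cos θ * F (η p.1) - Real.sin θ * (S (η p.1) * p.2)|
          ≤ |F (η p.1)| + |S (η p.1) * p.2| := by
        refine (abs_sub _ _).trans ?_
        rw [abs_mul, abs_mul (Real.sin θ)]
        exact add_le_add (mul_le_of_le_one_left (abs_nonneg _) c1)
          (mul_le_of_le_one_left (abs_nonneg _) s1)
      have k2 : |Real.sin θ * F (η p.1) + Real.cos θ * (S (η p.1) * p.2)|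
          ≤ |F (η p.1)| + |S (η p.1) * p.2| := by
        refine (abs_add_le _ _).trans ?_
        rw [abs_mul, abs_mul (Real.cos θ)]
        exact add_le_add (mul_le_of_le_one_left (abs_nonneg _) s1)
          (mul_le_of_le_one_left (abs_nonneg _) c1)
      have k3 : |h (Real.sin θ * F (η p.1) + Real.cos θ * (S (η p.1) * p.2))|
          ≤ |h 0| + a * (|F (η p.1)| + |S (η p.1) * p.2|) := by
        have h2 := hlip (Real.sin θ * F (η p.1) + Real.cos θ * (S (η p.1) * p.2)) 0
        have h3 := abs_sub_abs_le_abs_sub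
          (h (Real.sin θ * F (η p.1) + Real.cos θ * (S (η p.1) * p.2))) (h 0)
        rw [sub_zero] at h2
        have := mul_le_mul_of_nonneg_left k2 a0
        linarith
      exact mul_le_mul k3 k1 (abs_nonneg _) (by positivity)
    · refine ae_of_all _ fun p θ _ => ?_
      have := (hf (Real.sin θ * F (η p.1) + Real.cos θ * (S (η p.1) * p.2))).comp θ
        (((Real.hasDerivAt_sin θ).mul_const (F (η p.1))).add
          ((Real.hasDerivAt_cos θ).mul_const (S (η p.1) * p.2)))
      exact this.congr_deriv (by ring)
  -- The comparison function is a primitive of the derivative bound. The weights sin cos, cos³ and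
  -- sin² cos have integrals 1/2, 2/3 and 1/3 over [0, π/2].
  have hmain := image_norm_le_of_norm_deriv_right_le_deriv_boundary
    (f := fun θ => g θ - g 0) (a := 0) (b := Real.pi / 2)
    (B := fun θ => a * A * (Real.sin θ ^ 2 / 2)
      + L * (B + E / 2) * (Real.sin θ - Real.sin θ ^ 3 / 3) + L * (C / 2) * (Real.sin θ ^ 3 / 3))
    (B' := fun θ => a * A * (Real.sin θ * Real.cos θ)
      + L * (B + E / 2) * (Real.cos θ - Real.sin θ ^ 2 * Real.cos θ)
      + L * (C / 2) * (Real.sin θ ^ 2 * Real.cos θ))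
    (fun θ _ => ((hderiv θ).sub_const _).continuousAt.continuousWithinAt)
    (fun θ _ => ((hderiv θ).sub_const _).hasDerivWithinAt) (by simp)
    (fun θ => by
      have d2 : HasDerivAt (fun θ => Real.sin θ ^ 2 / 2) (Real.sin θ * Real.cos θ) θ :=
        (((Real.hasDerivAt_sin θ).pow 2).div_const 2).congr_deriv (by norm_num; ring)
      have d3 : HasDerivAt (fun θ => Real.sin θ ^ 3 / 3) (Real.sin θ ^ 2 * Real.cos θ) θ :=
        (((Real.hasDerivAt_sin θ).pow 3).div_const 3).congr_deriv (by norm_num; ring)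
      exact ((d2.const_mul _).add (((Real.hasDerivAt_sin θ).sub d3).const_mul _)).add
        (d3.const_mul _))
    (fun θ hθ => by
      have hs : 0 ≤ Real.sin θ :=
        Real.sin_nonneg_of_nonneg_of_le_pi hθ.1 (by linarith [hθ.2, Real.pi_pos])
      have hc : 0 ≤ Real.cos θ :=
        Real.cos_nonneg_of_neg_pi_div_two_le_of_le (by linarith [hθ.1, Real.pi_pos]) hθ.2.le
      refine (abs_integral_deriv_interpolation_le hF hS hu hh ha hc' hL hC hE hB he hdec hs
        hc).trans_eq ?_
      rw [← hBdef, ← hCdef, ← hEdef]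
      have : Real.cos θ ^ 2 = 1 - Real.sin θ ^ 2 := by
        linarith [Real.sin_sq_add_cos_sq θ]
      rw [this]; ring)
    (Set.right_mem_Icc.2 (by positivity))
  have g1 : g (Real.pi / 2) = ∫ ω, f (F (η ω)) ∂P := by
    simp only [hg, Real.sin_pi_div_two, Real.cos_pi_div_two, one_mul, zero_mul, add_zero]
    rw [integral_fun_fst (fun ω => f (F (η ω)))]; simp
  have g0 : g 0 = ∫ p : Ω × ℝ, f (S (η p.1) * p.2) ∂(P.prod γ) := by
    simp only [hg, Real.sin_zero, Real.cos_zero, one_mul, zero_mul, zero_add]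
  rw [g1, g0, Real.sin_pi_div_two, Real.norm_eq_abs] at hmain
  exact hmain.trans_eq (by ring)

end Interpolation

end PoissonSpace

/-! ### Gaussian mixtures and the choice of the smoothing width. -/

namespace PoissonSpace

open GaussianCalculus RealTransport

theorem isProbabilityMeasure_gaussianMixture (μ : Measure ℝ) [IsProbabilityMeasure μ] :
    IsProbabilityMeasure (gaussianMixture μ) :=
  Measure.isProbabilityMeasure_map (by fun_prop)

theorem gaussianMixture_map {α : Type*} [MeasurableSpace α] {μ : Measure α} [SFinite μ]
    {X : α → ℝ} (hX : Measurable X) :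
    gaussianMixture (μ.map X) = (μ.prod γ).map fun p => X p.1 * p.2 := by
  have h : (μ.map X).prod γ = (μ.prod γ).map (Prod.map X id) := by
    rw [← Measure.map_prod_map μ γ hX measurable_id, Measure.map_id]
  rw [gaussianMixture, h, Measure.map_map (by fun_prop) (by fun_prop)]
  rfl

theorem lintegral_enorm_gaussian : ∫⁻ y, ‖y‖ₑ ∂γ = ENNReal.ofReal (Real.sqrt (2 / Real.pi)) := by
  rw [← ofReal_integral_norm_eq_lintegral_enorm integrable_id_gaussian, ← integral_abs_gaussian]
  rfl

theorem d1_gaussianMixture_le (μ₁ μ₂ : Measure ℝ) [IsProbabilityMeasure μ₁] :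
    d1 (gaussianMixture μ₁) (gaussianMixture μ₂)
      ≤ ENNReal.ofReal (Real.sqrt (2 / Real.pi)) * d1 μ₁ μ₂ := by
  have hq : 0 < Real.sqrt (2 / Real.pi) := Real.sqrt_pos.2 (by positivity)
  rw [← ENNReal.div_le_iff' (by simpa using hq) ENNReal.ofReal_ne_top]
  refine le_iInf fun π => le_iInf fun h1 => le_iInf fun h2 => ?_
  have : IsProbabilityMeasure π := by
    constructor
    have := congrArg (fun m => m Set.univ) h1
    simpa [Measure.map_apply measurable_fst] using this
  refine ENNReal.div_le_of_le_mul' ?_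
  refine (d1_le_of_coupling ((π.prod γ).map fun r : (ℝ × ℝ) × ℝ => (r.1.1 * r.2, r.1.2 * r.2))
    ?_ ?_).trans_eq ?_
  · rw [← h1, gaussianMixture_map measurable_fst, Measure.map_map (by fun_prop) (by fun_prop)]
    rfl
  · rw [← h2, gaussianMixture_map measurable_snd, Measure.map_map (by fun_prop) (by fun_prop)]
    rfl
  · rw [lintegral_map (by fun_prop) (by fun_prop)]
    simp_rw [← sub_mul, enorm_mul]
    rw [lintegral_prod_mul (f := fun p : ℝ × ℝ => ‖p.1 - p.2‖ₑ) (g := fun y : ℝ => ‖y‖ₑ)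
      (by fun_prop) (by fun_prop), lintegral_enorm_gaussian, mul_comm]

/-- Here 2q + M and α + D stand for Δ₁ and Δ₂, and x = (2Δ₂/Δ₁)^{1/3}; the target 3/2 · Δ₁ x is the
first entry of the maximum. The choice y = x works for small x and the trivial bound `hM` for large
x; an intermediate window is settled numerically. -/
theorem le_of_smoothing_bounds_aux {d M α D q x : ℝ} (hq0 : 1.59 ≤ 2 * q) (hq1 : 2 * q ≤ 1.6)
    (hM0 : 0 ≤ M) (hα : 0 ≤ α) (hD : 0 ≤ D) (hM : d ≤ M)
    (h : ∀ y : ℝ, 0 < y → d ≤ 2 * q * y + 2.1 * α / y + D / y ^ 2)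
    (hx : 0 ≤ x) (hx3 : x ^ 3 * (2 * q + M) = 2 * (α + D)) :
    d ≤ 3 / 2 * (2 * q + M) * x := by
  -- If x = 0, both error terms vanish and y may tend to 0.
  rcases hx.eq_or_lt with rfl | hx
  · have hα0 : α = 0 := by norm_num at hx3; linarith
    have hD0 : D = 0 := by norm_num at hx3; linarith
    rw [mul_zero]
    refine le_of_forall_pos_le_add fun δ hδ => ?_
    have := h (δ / 2) (by positivity)
    rw [hα0, hD0] at this
    norm_num at this
    nlinarith
  rcases le_or_gt (2 / 3) x with h1 | h1
  · nlinarith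
  -- Since 2.1 · 0.47 < 1, the 1/y term is absorbed into 1/y² at y = x, and the bound becomes 2q x +
  -- Δ₁ x / 2.
  rcases le_or_gt x 0.47 with h2 | h2
  · have k1 : 2.1 * α / x ≤ α / x ^ 2 := by
      rw [div_le_div_iff₀ hx (by positivity)]
      nlinarith [mul_nonneg hα hx.le]
    have k2 : (α + D) / x ^ 2 = x * (2 * q + M) / 2 := by
      field_simp; linarith
    rw [add_div] at k2
    have := h x hx
    nlinarith
  -- For 0.47 < x < 2/3: a small M satisfies M ≤ 3/2 · 0.47 (2q + M), because 2q ≥ 1.59; for a large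
  -- M the choice y = 1 suffices, as 2q is then a small fraction of Δ₁.
  rcases le_or_gt M 3.7 with h3 | h3
  · nlinarith
  · have := h 1 one_pos
    have k1 : d ≤ 2 * q + 1.05 * (x ^ 3 * (2 * q + M)) := by
      norm_num at this ⊢; linarith
    have k2 : 2 * q ≤ 0.302 * (2 * q + M) := by linarith
    have k3 : 0.302 + 1.05 * x ^ 3 ≤ 3 / 2 * x := by nlinarith [mul_pos hx hx]
    nlinarith [mul_le_mul_of_nonneg_right k3 (by linarith : 0 ≤ 2 * q + M)]

theorem le_of_smoothing_bounds {d M α D : ℝ} (hM0 : 0 ≤ M) (hα : 0 ≤ α) (hD : 0 ≤ D)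
    (hM : d ≤ M) (h : ∀ y : ℝ, 0 < y → d ≤ 2 * Real.sqrt (2 / Real.pi) * y
      + 2 * Real.pi / 3 * α / y + 2 * Real.sqrt 2 * Real.pi / 9 * D / y ^ 2) :
    d ≤ ((2 : ℝ) ^ (1 / 3 : ℝ) + (2 : ℝ) ^ (-(2 / 3) : ℝ)) *
      (2 * Real.sqrt (2 / Real.pi) + M) ^ (2 / 3 : ℝ) * (α + D) ^ (1 / 3 : ℝ) := by
  have p1 := Real.pi_gt_d2
  have p2 := Real.pi_lt_d2
  have hq0 : 1.59 ≤ 2 * Real.sqrt (2 / Real.pi) := by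
    have : 1.59 / 2 ≤ Real.sqrt (2 / Real.pi) := by
      refine Real.le_sqrt_of_sq_le ?_
      rw [le_div_iff₀ Real.pi_pos]; norm_num at p2 ⊢; linarith
    linarith
  have hq1 : 2 * Real.sqrt (2 / Real.pi) ≤ 1.6 := by
    have : Real.sqrt (2 / Real.pi) ≤ 1.6 / 2 := by
      refine Real.sqrt_le_iff.2 ⟨by norm_num, ?_⟩
      rw [div_le_iff₀ Real.pi_pos]; norm_num at p1 ⊢; linarith
    linarith
  have hs2 : Real.sqrt 2 ≤ 1.415 := Real.sqrt_le_iff.2 ⟨by norm_num, by norm_num⟩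
  set q := Real.sqrt (2 / Real.pi)
  have hΔ : 0 < 2 * q + M := by linarith
  have hΔ2 : 0 ≤ α + D := by linarith
  set p := (2 * q + M) ^ (1 / 3 : ℝ)
  set r := (α + D) ^ (1 / 3 : ℝ)
  set t := (2 : ℝ) ^ (1 / 3 : ℝ)
  have hcube : ∀ {z : ℝ}, 0 ≤ z → (z ^ (1 / 3 : ℝ)) ^ 3 = z := fun {z} hz => by
    rw [← Real.rpow_natCast, ← Real.rpow_mul hz]; norm_num
  have hp : 0 < p := Real.rpow_pos_of_pos hΔ _
  have hr : 0 ≤ r := Real.rpow_nonneg hΔ2 _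
  have ht : 0 < t := Real.rpow_pos_of_pos two_pos _
  have hp3 : p ^ 3 = 2 * q + M := hcube hΔ.le
  have hr3 : r ^ 3 = α + D := hcube hΔ2
  have ht3 : t ^ 3 = 2 := hcube two_pos.le
  have e1 : (2 * q + M) ^ (2 / 3 : ℝ) = p ^ 2 := by
    rw [← Real.rpow_natCast, ← Real.rpow_mul hΔ.le]; norm_num
  have e2 : (2 : ℝ) ^ (-(2 / 3) : ℝ) = t / 2 := by
    rw [show (-(2 / 3) : ℝ) = 1 / 3 - 1 by norm_num, Real.rpow_sub two_pos, Real.rpow_one]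
  -- With t³ = 2 the constant 2^{1/3} + 2^{-2/3} equals 3t/2. The numerical coefficients are relaxed
  -- using 2π/3 < 2.1 and 2√2 π/9 < 1.
  have := le_of_smoothing_bounds_aux (x := t * r / p) hq0 hq1 hM0 hα hD hM (fun y hy => ?_)
    (by positivity) (by rw [div_pow, mul_pow, ht3, hr3, hp3]; field_simp)
  · rw [e1, e2]
    refine this.trans_eq ?_
    rw [← hp3]; field_simp; ring
  · refine (h y hy).trans ?_
    have k1 : 2 * Real.pi / 3 * α / y ≤ 2.1 * α / y := by
      refine div_le_div_of_nonneg_right (mul_le_mul_of_nonneg_right ?_ hα) hy.le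
      norm_num at p2 ⊢; linarith
    have k2 : 2 * Real.sqrt 2 * Real.pi / 9 * D / y ^ 2 ≤ D / y ^ 2 := by
      refine div_le_div_of_nonneg_right (mul_le_of_le_one_left hD ?_) (by positivity)
      have := mul_le_mul hs2 p2.le Real.pi_pos.le (by norm_num)
      norm_num at this ⊢; linarith
    linarith

section Bound

variable {Ω Z : Type*} [MeasurableSpace Ω] [MeasurableSpace Z] {P : Measure Ω}
  [IsProbabilityMeasure P] {ν : Measure Z} [SigmaFinite ν] {η : Ω → PointMeasure Z}
  {F S : PointMeasure Z → ℝ} {u : PointMeasure Z → Z → ℝ}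

theorem abs_integral_sub_const_le {α : Type*} [MeasurableSpace α] {μ : Measure α}
    [IsProbabilityMeasure μ] {φ : ℝ → ℝ} (hφ : LipschitzWith 1 φ) {X : α → ℝ}
    (hX : Integrable X μ) : |∫ x, φ (X x) ∂μ - φ 0| ≤ ∫ x, |X x| ∂μ := by
  have : ∫ x, φ (X x) ∂μ - φ 0 = ∫ x, (φ (X x) - φ 0) ∂μ := by
    rw [integral_sub (integrable_comp_of_lipschitz hφ hX) (integrable_const _)]; simp
  rw [this]
  refine abs_integral_le_of_abs_le hX.abs fun x => ?_
  simpa [Real.dist_eq] using hφ.dist_le_mul (X x) 0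

theorem abs_integral_sub_integral_le {α : Type*} [MeasurableSpace α] {μ : Measure α}
    [IsProbabilityMeasure μ] {f g : α → ℝ} (hf : Integrable f μ) (hg : Integrable g μ) {r : ℝ}
    (h : ∀ x, |f x - g x| ≤ r) : |∫ x, f x ∂μ - ∫ x, g x ∂μ| ≤ r := by
  rw [← integral_sub hf hg]
  refine (abs_integral_le_of_abs_le (integrable_const r) h).trans_eq (by simp)

theorem abs_integral_lipschitz_sub_le (hF : MemDomD η P ν F) (hS : MemDomD η P ν S)
    (hu : IsDivergence η P ν u F)
    (hC : Integrable (fun p : Ω × Z => |u (η p.1) p.2| * addOp F (η p.1) p.2 ^ 2) (P.prod ν))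
    (hE : Integrable (fun p : Ω × Z => |u (η p.1) p.2| * addOp S (η p.1) p.2 ^ 2) (P.prod ν))
    (hB : Integrable (fun ω => |S (η ω) * bracket ν (u (η ω)) (addOp S (η ω))|) P)
    {e : Ω → ℝ} (he : Integrable e P)
    (hdec : ∀ᵐ ω ∂P, bracket ν (u (η ω)) (addOp F (η ω)) = S (η ω) ^ 2 + e ω)
    {φ : ℝ → ℝ} (hφ : LipschitzWith 1 φ) :
    |∫ ω, φ (F (η ω)) ∂P - ∫ p : Ω × ℝ, φ (S (η p.1) * p.2) ∂(P.prod γ)|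
      ≤ ((2 : ℝ) ^ (1 / 3 : ℝ) + (2 : ℝ) ^ (-(2 / 3) : ℝ)) *
      (2 * Real.sqrt (2 / Real.pi) + (Real.sqrt (2 / Real.pi) * ∫ ω, |S (η ω)| ∂P
        + ∫ ω, |F (η ω)| ∂P)) ^ (2 / 3 : ℝ) *
      (1 / 4 * Real.sqrt (2 / Real.pi) * ∫ ω, |e ω| ∂P + Real.sqrt 2 * (1 / 3 *
        ∫ ω, |S (η ω) * bracket ν (u (η ω)) (addOp S (η ω))| ∂P + 1 / 6 *
        (∫ p : Ω × Z, |u (η p.1) p.2| * addOp F (η p.1) p.2 ^ 2 ∂(P.prod ν)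
          + ∫ p : Ω × Z, |u (η p.1) p.2| * addOp S (η p.1) p.2 ^ 2 ∂(P.prod ν))))
        ^ (1 / 3 : ℝ) := by
  have hFi : Integrable (fun ω => F (η ω)) P := hF.memLp.integrable one_le_two
  have hSi : Integrable (fun p : Ω × ℝ => S (η p.1) * p.2) (P.prod γ) :=
    (memLp_mul_gaussian hS.memLp).integrable one_le_two
  have A0 : 0 ≤ ∫ ω, |e ω| ∂P := integral_nonneg fun _ => abs_nonneg _
  have B0 : 0 ≤ ∫ ω, |S (η ω) * bracket ν (u (η ω)) (addOp S (η ω))| ∂P :=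
    integral_nonneg fun _ => abs_nonneg _
  have C0 : 0 ≤ ∫ p : Ω × Z, |u (η p.1) p.2| * addOp F (η p.1) p.2 ^ 2 ∂(P.prod ν) :=
    integral_nonneg fun _ => mul_nonneg (abs_nonneg _) (sq_nonneg _)
  have E0 : 0 ≤ ∫ p : Ω × Z, |u (η p.1) p.2| * addOp S (η p.1) p.2 ^ 2 ∂(P.prod ν) :=
    integral_nonneg fun _ => mul_nonneg (abs_nonneg _) (sq_nonneg _)
  have S0 : 0 ≤ ∫ ω, |S (η ω)| ∂P := integral_nonneg fun _ => abs_nonneg _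
  have F0 : 0 ≤ ∫ ω, |F (η ω)| ∂P := integral_nonneg fun _ => abs_nonneg _
  have hq : 0 < Real.sqrt (2 / Real.pi) := Real.sqrt_pos.2 (by positivity)
  refine le_of_smoothing_bounds (by positivity) (by positivity) (by positivity) ?_
    (fun y hy => ?_)
  · have h1 := abs_integral_sub_const_le hφ hFi
    have h2 := abs_integral_sub_const_le hφ hSi
    have h3 : ∫ p : Ω × ℝ, |S (η p.1) * p.2| ∂(P.prod γ)
        = Real.sqrt (2 / Real.pi) * ∫ ω, |S (η ω)| ∂P := by
      simp_rw [abs_mul]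
      rw [integral_prod_mul (fun ω => |S (η ω)|) (fun y : ℝ => |y|), integral_abs_gaussian,
        mul_comm]
    rw [h3] at h2
    rw [abs_sub_comm] at h2
    have := abs_add_le (∫ ω, φ (F (η ω)) ∂P - φ 0)
      (φ 0 - ∫ p : Ω × ℝ, φ (S (η p.1) * p.2) ∂(P.prod γ))
    rw [sub_add_sub_cancel] at this
    linarith
  · have hσ : 0 < 3 * Real.sqrt (2 / Real.pi) * y := by positivity
    obtain ⟨f, h, h', hf, hh, ha, hL, hfφ⟩ := exists_smoothing hφ hσ
    have hlip := abs_le_of_hasDerivAt hh ha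
    have k1 := abs_integral_test_sub_le hF hS hu hf hh ha hL hC hE hB he hdec
    have k2 := abs_integral_sub_integral_le (integrable_comp_of_memLp hf hlip hF.memLp)
      (integrable_comp_of_lipschitz hφ hFi) fun ω => hfφ (F (η ω))
    have k3 := abs_integral_sub_integral_le
      (integrable_comp_of_memLp hf hlip (memLp_mul_gaussian hS.memLp))
      (integrable_comp_of_lipschitz hφ hSi) fun p => hfφ (S (η p.1) * p.2)
    set A := ∫ ω, |e ω| ∂P
    set B := ∫ ω, |S (η ω) * bracket ν (u (η ω)) (addOp S (η ω))| ∂P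
    set C := ∫ p : Ω × Z, |u (η p.1) p.2| * addOp F (η p.1) p.2 ^ 2 ∂(P.prod ν)
    set E := ∫ p : Ω × Z, |u (η p.1) p.2| * addOp S (η p.1) p.2 ^ 2 ∂(P.prod ν)
    set q := Real.sqrt (2 / Real.pi) with hqdef
    have hq2 : Real.pi * q ^ 2 = 2 := by
      rw [hqdef, Real.sq_sqrt (by positivity)]; field_simp
    have hs2 : Real.sqrt 2 ^ 2 = 2 := Real.sq_sqrt (by norm_num)
    have e1 : 2 / (3 * q * y) / 2 * A = 2 * Real.pi / 3 * (1 / 4 * q * A) / y := by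
      field_simp; linear_combination (-2 * A) * hq2
    -- The weight 1/6 of the |DF|² term is raised to 1/3, which makes the bracket proportional to
    -- the second part of Δ₂.
    have e2 : 4 / (3 * q * y) ^ 2 * (2 / 3 * B + 1 / 6 * C + 1 / 3 * E)
        ≤ 2 * Real.sqrt 2 * Real.pi / 9 * (Real.sqrt 2 * (1 / 3 * B + 1 / 6 * (C + E)))
          / y ^ 2 := by
      have : 2 * Real.sqrt 2 * Real.pi / 9 * (Real.sqrt 2 * (1 / 3 * B + 1 / 6 * (C + E))) / y ^ 2
          = 4 / (3 * q * y) ^ 2 * (2 / 3 * B + 1 / 3 * C + 1 / 3 * E) := by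
        field_simp
        rw [hs2]
        linear_combination (108 * (2 * B + C + E)) * hq2
      rw [this]
      exact mul_le_mul_of_nonneg_left (by linarith) (by positivity)
    have c1 := abs_le.1 k1
    have c2 := abs_le.1 k2
    have c3 := abs_le.1 k3
    exact abs_le.2 ⟨by linarith, by linarith⟩

end Bound

end PoissonSpace

/-! ### Extended-real quantities and the final estimate. -/

namespace PoissonSpace

open GaussianCalculus RealTransport

section Bound

variable {Ω Z : Type*} [MeasurableSpace Ω] [MeasurableSpace Z] {P : Measure Ω}
  [IsProbabilityMeasure P] {ν : Measure Z} {η : Ω → PointMeasure Z}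
  {F S ε : PointMeasure Z → ℝ} {u : PointMeasure Z → Z → ℝ}

theorem Delta1_eq_ofReal (hF : MemDomD η P ν F) (hS : MemDomD η P ν S) :
    Delta1 η P F S = ENNReal.ofReal (2 * Real.sqrt (2 / Real.pi) +
      (Real.sqrt (2 / Real.pi) * ∫ ω, |S (η ω)| ∂P + ∫ ω, |F (η ω)| ∂P)) := by
  have hFi : Integrable (fun ω => F (η ω)) P := hF.memLp.integrable one_le_two
  have hSi : Integrable (fun ω => S (η ω)) P := hS.memLp.integrable one_le_two
  have S0 : 0 ≤ ∫ ω, |S (η ω)| ∂P := integral_nonneg fun _ => abs_nonneg _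
  have F0 : 0 ≤ ∫ ω, |F (η ω)| ∂P := integral_nonneg fun _ => abs_nonneg _
  have q0 := Real.sqrt_nonneg (2 / Real.pi)
  rw [Delta1, ← ofReal_integral_norm_eq_lintegral_enorm hFi,
    ← ofReal_integral_norm_eq_lintegral_enorm hSi]
  simp only [Real.norm_eq_abs]
  rw [show (2 : ℝ≥0∞) = ENNReal.ofReal 2 by simp, ← ENNReal.ofReal_add zero_le_two S0,
    ← ENNReal.ofReal_mul q0, ← ENNReal.ofReal_add (by positivity) F0]
  congr 1; ring

/-- Δ₂ is a sum of nonnegative terms with positive coefficients, so its finiteness supplies every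
integrability needed by the real-valued estimates. -/
theorem integrable_remainders [SigmaFinite ν] (hη : Measurable η) (hF : MemDomD η P ν F)
    (hS : MemDomD η P ν S)
    (hu : MemDomDelta η P ν u) (hε : Measurable ε) (hΔ : Delta2 η P ν u F S ε ≠ ∞) :
    Integrable (fun ω => ε (η ω)) P ∧
    Integrable (fun ω => S (η ω) * bracket ν (u (η ω)) (addOp S (η ω))) P ∧
    Integrable (fun p : Ω × Z => |u (η p.1) p.2| * addOp F (η p.1) p.2 ^ 2) (P.prod ν) ∧
    Integrable (fun p : Ω × Z => |u (η p.1) p.2| * addOp S (η p.1) p.2 ^ 2) (P.prod ν) ∧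
    Delta2 η P ν u F S ε = ENNReal.ofReal
      (1 / 4 * Real.sqrt (2 / Real.pi) * ∫ ω, |ε (η ω)| ∂P + Real.sqrt 2 * (1 / 3 *
        ∫ ω, |S (η ω) * bracket ν (u (η ω)) (addOp S (η ω))| ∂P + 1 / 6 *
        (∫ p : Ω × Z, |u (η p.1) p.2| * addOp F (η p.1) p.2 ^ 2 ∂(P.prod ν)
          + ∫ p : Ω × Z, |u (η p.1) p.2| * addOp S (η p.1) p.2 ^ 2 ∂(P.prod ν)))) := by
  have hq : 0 < 1 / 4 * Real.sqrt (2 / Real.pi) :=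
    mul_pos (by norm_num) (Real.sqrt_pos.2 (by positivity))
  have hcoef : ∀ {c : ℝ}, 0 < c → ENNReal.ofReal c ≠ 0 := fun hc => by simpa using hc
  have hfin : ∀ {c : ℝ} {x : ℝ≥0∞}, 0 < c → ENNReal.ofReal c * x ≠ ∞ → x < ∞ :=
    fun hc h => lt_top_iff_ne_top.2 fun hx => h (by rw [hx, ENNReal.mul_top (hcoef hc)])
  set w : Ω × Z → ℝ := fun p => |u (η p.1) p.2| * addOp F (η p.1) p.2 ^ 2
    + |u (η p.1) p.2| * addOp S (η p.1) p.2 ^ 2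
  have hCm : AEStronglyMeasurable (fun p : Ω × Z => |u (η p.1) p.2| * addOp F (η p.1) p.2 ^ 2)
      (P.prod ν) := hu.memLp.1.norm.mul (hF.memLp_addOp.1.pow 2)
  have hEm : AEStronglyMeasurable (fun p : Ω × Z => |u (η p.1) p.2| * addOp S (η p.1) p.2 ^ 2)
      (P.prod ν) := hu.memLp.1.norm.mul (hS.memLp_addOp.1.pow 2)
  have hC0 : ∀ p : Ω × Z, 0 ≤ |u (η p.1) p.2| * addOp F (η p.1) p.2 ^ 2 := fun p => by positivity
  have hE0 : ∀ p : Ω × Z, 0 ≤ |u (η p.1) p.2| * addOp S (η p.1) p.2 ^ 2 := fun p => by positivity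
  have hwe : ∀ p, ‖w p‖ₑ = ‖u (η p.1) p.2‖ₑ *
      (‖addOp F (η p.1) p.2‖ₑ ^ 2 + ‖addOp S (η p.1) p.2‖ₑ ^ 2) := fun p => by
    rw [Real.enorm_eq_ofReal (add_nonneg (hC0 p) (hE0 p)), ENNReal.ofReal_add (hC0 p) (hE0 p),
      ENNReal.ofReal_mul (abs_nonneg _), ENNReal.ofReal_mul (abs_nonneg _), ← mul_add,
      Real.enorm_eq_ofReal_abs, Real.enorm_eq_ofReal_abs, Real.enorm_eq_ofReal_abs,
      ← ENNReal.ofReal_pow (abs_nonneg _), ← ENNReal.ofReal_pow (abs_nonneg _), sq_abs, sq_abs]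
  have hlw : ∫⁻ ω, ∫⁻ z, ‖u (η ω) z‖ₑ *
      (‖addOp F (η ω) z‖ₑ ^ 2 + ‖addOp S (η ω) z‖ₑ ^ 2) ∂ν ∂P = ∫⁻ p, ‖w p‖ₑ ∂(P.prod ν) := by
    have hwm : AEStronglyMeasurable w (P.prod ν) := hCm.add hEm
    rw [lintegral_prod _ hwm.enorm]
    simp_rw [hwe]
  rw [Delta2, hlw] at hΔ
  obtain ⟨h1, h2⟩ := ENNReal.add_ne_top.1 hΔ
  obtain ⟨h3, h4⟩ := ENNReal.add_ne_top.1 (hfin (Real.sqrt_pos.2 two_pos) h2).ne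
  have iε : Integrable (fun ω => ε (η ω)) P :=
    ⟨(hε.comp hη).aestronglyMeasurable, hfin hq h1⟩
  have iB : Integrable (fun ω => S (η ω) * bracket ν (u (η ω)) (addOp S (η ω))) P :=
    ⟨hS.memLp.1.mul (integrable_bracket hu hS).1, hfin (by norm_num) h3⟩
  have iw : Integrable w (P.prod ν) := ⟨hCm.add hEm, hfin (by norm_num) h4⟩
  have iC := iw.mono' hCm (ae_of_all _ fun p => by
    rw [Real.norm_of_nonneg (hC0 p)]; exact le_add_of_nonneg_right (hE0 p))
  have iE := iw.mono' hEm (ae_of_all _ fun p => by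
    rw [Real.norm_of_nonneg (hE0 p)]; exact le_add_of_nonneg_left (hC0 p))
  refine ⟨iε, iB, iC, iE, ?_⟩
  have A0 : 0 ≤ ∫ ω, |ε (η ω)| ∂P := integral_nonneg fun _ => abs_nonneg _
  have B0 : 0 ≤ ∫ ω, |S (η ω) * bracket ν (u (η ω)) (addOp S (η ω))| ∂P :=
    integral_nonneg fun _ => abs_nonneg _
  have C0 : 0 ≤ ∫ p : Ω × Z, |u (η p.1) p.2| * addOp F (η p.1) p.2 ^ 2 ∂(P.prod ν) :=
    integral_nonneg hC0
  have E0 : 0 ≤ ∫ p : Ω × Z, |u (η p.1) p.2| * addOp S (η p.1) p.2 ^ 2 ∂(P.prod ν) :=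
    integral_nonneg hE0
  have ew : ∫ p, ‖w p‖ ∂(P.prod ν)
      = ∫ p : Ω × Z, |u (η p.1) p.2| * addOp F (η p.1) p.2 ^ 2 ∂(P.prod ν)
          + ∫ p : Ω × Z, |u (η p.1) p.2| * addOp S (η p.1) p.2 ^ 2 ∂(P.prod ν) := by
    rw [← integral_add iC iE]
    congr 1; ext p
    exact Real.norm_of_nonneg (add_nonneg (hC0 p) (hE0 p))
  rw [Delta2, hlw, ← ofReal_integral_norm_eq_lintegral_enorm iε,
    ← ofReal_integral_norm_eq_lintegral_enorm iB, ← ofReal_integral_norm_eq_lintegral_enorm iw, ew]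
  simp only [Real.norm_eq_abs]
  rw [← ENNReal.ofReal_mul hq.le, ← ENNReal.ofReal_mul (p := 1 / 3) (by norm_num),
    ← ENNReal.ofReal_mul (p := 1 / 6) (by norm_num),
    ← ENNReal.ofReal_add (by positivity) (by positivity),
    ← ENNReal.ofReal_mul (Real.sqrt_nonneg 2), ← ENNReal.ofReal_add (by positivity) (by positivity)]

theorem d1_gaussianMixture_of_divergence_le [SigmaFinite ν] (hη : Measurable η)
    (hF : MemDomD η P ν F)
    (hS : MemDomD η P ν S) (hu : IsDivergence η P ν u F) (hε : Measurable ε)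
    (hdec : ∀ᵐ ω ∂P, bracket ν (u (η ω)) (addOp F (η ω)) = S (η ω) ^ 2 + ε (η ω)) :
    d1 (P.map fun ω => F (η ω)) (gaussianMixture (P.map fun ω => S (η ω)))
      ≤ ENNReal.ofReal ((2 : ℝ) ^ (1 / 3 : ℝ) + (2 : ℝ) ^ (-(2 / 3) : ℝ)) *
          Delta1 η P F S ^ (2 / 3 : ℝ) * Delta2 η P ν u F S ε ^ (1 / 3 : ℝ) := by
  have hΔ1 := Delta1_eq_ofReal hF hS
  have hq : 0 < Real.sqrt (2 / Real.pi) := Real.sqrt_pos.2 (by positivity)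
  have S0 : 0 ≤ ∫ ω, |S (η ω)| ∂P := integral_nonneg fun _ => abs_nonneg _
  have F0 : 0 ≤ ∫ ω, |F (η ω)| ∂P := integral_nonneg fun _ => abs_nonneg _
  have hκ : (0 : ℝ) < (2 : ℝ) ^ (1 / 3 : ℝ) + (2 : ℝ) ^ (-(2 / 3) : ℝ) := by positivity
  by_cases hΔ : Delta2 η P ν u F S ε = ∞
  -- When Δ₂ = ∞ the right side is infinite, not 0 · ∞, because Δ₁ ≥ 2√(2/π) > 0.
  · rw [hΔ, ENNReal.top_rpow_of_pos (by norm_num), ENNReal.mul_top]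
    · exact le_top
    · refine mul_ne_zero (by simpa using hκ) ?_
      rw [hΔ1, ENNReal.ofReal_rpow_of_pos (by positivity)]
      simp only [ne_eq, ENNReal.ofReal_eq_zero, not_le]
      positivity
  obtain ⟨iε, iB, iC, iE, hΔ2⟩ := integrable_remainders hη hF hS hu.mem_dom hε hΔ
  have A0 : 0 ≤ ∫ ω, |ε (η ω)| ∂P := integral_nonneg fun _ => abs_nonneg _
  have B0 : 0 ≤ ∫ ω, |S (η ω) * bracket ν (u (η ω)) (addOp S (η ω))| ∂P :=
    integral_nonneg fun _ => abs_nonneg _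
  have C0 : 0 ≤ ∫ p : Ω × Z, |u (η p.1) p.2| * addOp F (η p.1) p.2 ^ 2 ∂(P.prod ν) :=
    integral_nonneg fun _ => mul_nonneg (abs_nonneg _) (sq_nonneg _)
  have E0 : 0 ≤ ∫ p : Ω × Z, |u (η p.1) p.2| * addOp S (η p.1) p.2 ^ 2 ∂(P.prod ν) :=
    integral_nonneg fun _ => mul_nonneg (abs_nonneg _) (sq_nonneg _)
  have mF : Measurable fun ω => F (η ω) := hF.measurable.comp hη
  have mS : Measurable fun ω => S (η ω) := hS.measurable.comp hη
  have : IsProbabilityMeasure (P.map fun ω => F (η ω)) :=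
    Measure.isProbabilityMeasure_map mF.aemeasurable
  have : IsProbabilityMeasure (P.map fun ω => S (η ω)) :=
    Measure.isProbabilityMeasure_map mS.aemeasurable
  have := isProbabilityMeasure_gaussianMixture (P.map fun ω => S (η ω))
  have mT : Measurable fun p : Ω × ℝ => S (η p.1) * p.2 :=
    (mS.comp measurable_fst).mul measurable_snd
  rw [hΔ1, hΔ2, ENNReal.ofReal_rpow_of_nonneg (by positivity) (by norm_num),
    ENNReal.ofReal_rpow_of_nonneg (by positivity) (by norm_num), ← ENNReal.ofReal_mul hκ.le,
    ← ENNReal.ofReal_mul (by positivity)]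
  refine d1_le_of_lipschitz _ _ ?_ ?_ fun φ hφ => ?_
  · rw [integrable_map_measure (by fun_prop) mF.aemeasurable]
    exact hF.memLp.integrable one_le_two
  · rw [gaussianMixture_map mS, integrable_map_measure (by fun_prop) mT.aemeasurable]
    exact (memLp_mul_gaussian hS.memLp).integrable one_le_two
  · rw [gaussianMixture_map mS, integral_map mF.aemeasurable hφ.continuous.aestronglyMeasurable,
      integral_map mT.aemeasurable hφ.continuous.aestronglyMeasurable]
    exact abs_integral_lipschitz_sub_le hF hS hu iC iE iB.abs iε hdec hφ

end Bound

end PoissonSpace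

theorem mainTheorem6 {Ω Z : Type*} [MeasurableSpace Ω] [MeasurableSpace Z]
    (P : Measure Ω) [IsProbabilityMeasure P] (ν : Measure Z) [SigmaFinite ν]
    (η : Ω → PointMeasure Z) (hη : IsPoissonProcess η P ν)
    (F : ℕ → PointMeasure Z → ℝ) (hF : ∀ n, MemDomD η P ν (F n))
    (S : Ω → ℝ) (hS : MemLp S 2 P)
    (u : ℕ → PointMeasure Z → Z → ℝ) (hFu : ∀ n, IsDivergence η P ν (u n) (F n))
    -- (W_ν): asymptotic independence
    (hW : ∀ h : Z → ℝ, MemLp h 2 ν →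
      Tendsto (fun n => ∫⁻ ω, ‖bracket ν (u n (η ω)) h‖ₑ ∂P) atTop (𝓝 0))
    -- (R₃)
    (hR3 : Tendsto (fun n => ∫⁻ ω, ∫⁻ z, ‖u n (η ω) z‖ₑ * ‖addOp (F n) (η ω) z‖ₑ ^ 2 ∂ν ∂P)
      atTop (𝓝 0))
    -- the decomposition `[u_n, DF_n]_ν = C_n + ε_n` with `C_n = S_n²`, for `n` sufficiently big
    (Sn : ℕ → PointMeasure Z → ℝ) (hSn : ∀ n, MemDomD η P ν (Sn n))
    (ε : ℕ → PointMeasure Z → ℝ) (hε_meas : ∀ n, Measurable (ε n))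
    (n₀ : ℕ)
    (hdec : ∀ n, n₀ ≤ n → ∀ᵐ ω ∂P,
      bracket ν (u n (η ω)) (addOp (F n) (η ω)) = Sn n (η ω) ^ 2 + ε n (η ω))
    -- (C.st)
    (hC : StableConvergence η P (fun n ω => Sn n (η ω) ^ 2) (fun ω => S ω ^ 2))
    -- (ε)
    (hε : Tendsto (fun n => ∫⁻ ω, ‖ε n (η ω)‖ₑ ∂P) atTop (𝓝 0))
    -- (RS)
    (hRS : Tendsto (fun n => ∫⁻ ω,
      ‖bracket ν (u n (η ω)) (fun z => addOp (Sn n) (η ω) z * Sn n (η ω))‖ₑ ∂P) atTop (𝓝 0))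
    -- (Rh)
    (hRh : ∀ h : Z → ℝ, MemLp h 2 ν →
      Tendsto (fun n => ∫⁻ ω, ∫⁻ z, ‖h z‖ₑ * ‖addOp (F n) (η ω) z‖ₑ ^ 2 ∂ν ∂P) atTop (𝓝 0))
    -- (S₃)
    (hS3 : Tendsto (fun n => ∫⁻ ω, ∫⁻ z, ‖u n (η ω) z‖ₑ * ‖addOp (Sn n) (η ω) z‖ₑ ^ 2 ∂ν ∂P)
      atTop (𝓝 0))
    -- (Sh)
    (hSh : ∀ h : Z → ℝ, MemLp h 2 ν →
      Tendsto (fun n => ∫⁻ ω, ∫⁻ z, ‖h z‖ₑ * ‖addOp (Sn n) (η ω) z‖ₑ ^ 2 ∂ν ∂P) atTop (𝓝 0)) :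
    ∀ n, n₀ ≤ n →
      d1 (P.map (fun ω => F n (η ω))) (gaussianMixture (P.map S)) ≤
          max
            (ENNReal.ofReal ((2 : ℝ) ^ (1 / 3 : ℝ) + (2 : ℝ) ^ (-(2 / 3) : ℝ)) *
              Delta1 η P (F n) (Sn n) ^ (2 / 3 : ℝ) *
              Delta2 η P ν (u n) (F n) (Sn n) (ε n) ^ (1 / 3 : ℝ))
            (Delta1 η P (F n) (Sn n) * Delta2 η P ν (u n) (F n) (Sn n) (ε n))
          + ENNReal.ofReal (Real.sqrt (2 / Real.pi)) *
            d1 (P.map (fun ω => Sn n (η ω))) (P.map S) ∧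
      d1 (gaussianMixture (P.map (fun ω => Sn n (η ω)))) (gaussianMixture (P.map S)) ≤
          ENNReal.ofReal (Real.sqrt (2 / Real.pi)) *
            d1 (P.map (fun ω => Sn n (η ω))) (P.map S) := by
  intro n hn
  have hη' := hη.measurable
  have mS : Measurable fun ω => Sn n (η ω) := (hSn n).measurable.comp hη'
  have : IsProbabilityMeasure (P.map fun ω => F n (η ω)) :=
    Measure.isProbabilityMeasure_map ((hF n).measurable.comp hη').aemeasurable
  have : IsProbabilityMeasure (P.map fun ω => Sn n (η ω)) :=
    Measure.isProbabilityMeasure_map mS.aemeasurable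
  have : IsProbabilityMeasure (P.map S) := Measure.isProbabilityMeasure_map hS.1.aemeasurable
  have := isProbabilityMeasure_gaussianMixture (P.map fun ω => Sn n (η ω))
  have := isProbabilityMeasure_gaussianMixture (P.map S)
  have hmix := d1_gaussianMixture_le (P.map fun ω => Sn n (η ω)) (P.map S)
  -- The intermediate law is that of S_n N.
  refine ⟨(RealTransport.d1_triangle _ (gaussianMixture (P.map fun ω => Sn n (η ω))) _).trans
    (add_le_add (le_max_of_le_left ?_) hmix), hmix⟩
  exact d1_gaussianMixture_of_divergence_le hη' (hF n) (hSn n) (hFu n) (hε_meas n) (hdec n hn)
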